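/- **Notation.** Let $q$ be a complex number with $0<|q|<1$, fix a square root $q^{1/2}$ of $q$, and write $q^{e/2}=(q^{1/2})^e$ for $e\in\mathbb Z$. Put $(a;q)_\infty=\prod_{j\ge 0}(1-aq^j)$ and $(a;q)_k=(a;q)_\infty/(aq^k;q)_\infty$ for $k\in\mathbb Z$; write $(a)_k=(a;q)_k$, $(a)_\infty=(a;q)_\infty$ and $(a,b,c;p)_\infty=(a;p)_\infty(b;p)_\infty(c;p)_\infty$. Put $\left[{N\atop j}\right]=\frac{(q)_N}{(q)_j(q)_{N-j}}$ if $0\le j\le N$, and $\left[{N\atop j}\right]=0$ otherwise. All sums are over integers $s_j$, and the multiple series below converge absolutely. **Theorem.** Let $m\ge 0$, $r\ge 2$ and $0\le i\le r-1$ be integers. Then $$\sum_{s_1\ge\dots\ge s_r\ge-\lfloor m/2\rfloor}\frac{q^{s_1^2/2+s_2^2+\dots+s_r^2+m(s_1/2+s_2+\dots+s_r)+s_1/2-(s_1+\dots+s_i)}\,(-q^{m/2})_{s_1}(-q^{(m+1)/2})_{s_r}}{(q)_{s_1-s_2}\cdots(q)_{s_{r-1}-s_r}\,(-q^{(m+1)/2})_{s_{r-1}}}(-1)^{s_r}q^{-(m+1)s_r/2}\left[{m+s_r\atop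 m+2s_r}\right]=d_m,$$ where, for all integers $m\ge 0$, $$d_{2m}=\frac{(-q^m)_\infty}{2(q)_\infty}\sum_{k=0}^{2i}\sum_{\ell=0}^{2m}(-1)^\ell q^{mk+m\ell}\left(q^{2r-1},q^{2mr+r-i-2m+k+\ell-1/2},q^{r+i+2m-2mr-k-\ell-1/2};q^{2r-1}\right)_\infty$$ and $$d_{2m+1}=(-1)^mq^{(3-2r)m^2/2+(1+i-r)m}\frac{(-q^{(2m+1)/2})_\infty}{(q)_\infty}\sum_{\ell=0}^{m}q^{\ell}\left(q^{2r-1},q^{2r-i-m+2\ell-3/2},q^{i+m-2\ell+1/2};q^{2r-1}\right)_\infty.$$ Moreover, for the same $r$ and $i$, $$\sum_{s_1\ge\dots\ge s_{r-1}\ge 0}\frac{q^{s_1^2/2+s_2^2+\dots+s_{r-1}^2+s_1/2-(s_1+\dots+s_i)}\,(-1)_{s_1}}{(q)_{s_1-s_2}\cdots(q)_{s_{r-2}-s_{r-1}}(q)_{s_{r-1}}(-q^{1/2})_{s_{r-1}}}=\frac{(-q)_\infty}{(q)_\infty}\sum_{k=0}^{2i}\left(q^{2r-1},q^{r-i+k-1/2},q^{r+i-k-1/2};q^{2r-1}\right)_\infty.$$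 -/

import Mathlib

namespace QSeries

noncomputable section

/-- `(a; q)_∞ = ∏_{j ≥ 0} (1 - a q^j)`; the product converges when `‖q‖ < 1`. -/
def qInf (a q : ℂ) : ℂ := ∏' j : ℕ, (1 - a * q ^ j)

/-- `(a; q)_k = (a; q)_∞ / (a q^k; q)_∞` for every integer `k`. -/
def qPoch (a q : ℂ) (k : ℤ) : ℂ := qInf a q / qInf (a * q ^ k) q

/-- `(a, b, c; q)_∞ = (a; q)_∞ (b; q)_∞ (c; q)_∞`. -/
def qInf₃ (a b c q : ℂ) : ℂ := qInf a q * qInf b q * qInf c q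

/-- The `q`-binomial coefficient `[N over j]_q`, equal to `0` unless `0 ≤ j ≤ N`. -/
def qBinom (q : ℂ) (N j : ℤ) : ℂ :=
  if 0 ≤ j ∧ j ≤ N then qPoch q q N / (qPoch q q j * qPoch q q (N - j)) else 0

/-- The integer sequences `s_1 ≥ ⋯ ≥ s_n ≥ lo`. -/
def chains (n : ℕ) (lo : ℤ) : Set (Fin n → ℤ) := {s | Antitone s ∧ ∀ j, lo ≤ s j}

/-- The entry `s_j`, with `j` counted from `1` to `n` (and `0` for any other `j`). -/
def entry {n : ℕ} (s : Fin n → ℤ) (j : ℕ) : ℤ :=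
  if h : 1 ≤ j ∧ j ≤ n then s ⟨j - 1, by omega⟩ else 0

/-- The summand of the `m`-version for `s = (s_1, …, s_r)`. Here `w` stands for `q^{1/2}`, so
`q^{e/2}` is written `w ^ e`; the exponent of `w` below is twice the exponent of `q`, which is
`s_1²/2 + s_2² + ⋯ + s_r² + m (s_1/2 + s_2 + ⋯ + s_r) + s_1/2 - (s_1 + ⋯ + s_i) - (m+1) s_r/2`. -/
def mTerm (q w : ℂ) (r i m : ℕ) (s : Fin r → ℤ) : ℂ :=
  w ^ (entry s 1 ^ 2 + 2 * ∑ j ∈ Finset.Icc 2 r, entry s j ^ 2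
        + m * (entry s 1 + 2 * ∑ j ∈ Finset.Icc 2 r, entry s j)
        + entry s 1 - 2 * ∑ j ∈ Finset.Icc 1 i, entry s j
        - (m + 1) * entry s r)
    * (qPoch (-w ^ m) q (entry s 1) * qPoch (-w ^ (m + 1)) q (entry s r))
    / ((∏ j ∈ Finset.Icc 1 (r - 1), qPoch q q (entry s j - entry s (j + 1)))
        * qPoch (-w ^ (m + 1)) q (entry s (r - 1)))
    * (-1) ^ entry s r * qBinom q (m + entry s r) (m + 2 * entry s r)

/-- `d_{2m}`, with `w` standing for `q^{1/2}`. -/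
def dEven (q w : ℂ) (r i m : ℕ) : ℂ :=
  qInf (-q ^ m) q / (2 * qInf q q) *
    ∑ k ∈ Finset.range (2 * i + 1), ∑ l ∈ Finset.range (2 * m + 1),
      (-1) ^ l * q ^ (m * k + m * l) *
        qInf₃ (q ^ (2 * r - 1))
          (w ^ (2 * (2 * m * r + r - i - 2 * m + k + l) - 1 : ℤ))
          (w ^ (2 * (r + i + 2 * m - 2 * m * r - k - l) - 1 : ℤ))
          (q ^ (2 * r - 1))

/-- `d_{2m+1}`, with `w` standing for `q^{1/2}`. -/
def dOdd (q w : ℂ) (r i m : ℕ) : ℂ :=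
  (-1) ^ m * w ^ ((3 - 2 * r) * m ^ 2 + 2 * (1 + i - r) * m : ℤ) *
    (qInf (-w ^ (2 * m + 1)) q / qInf q q) *
    ∑ l ∈ Finset.range (m + 1),
      q ^ l *
        qInf₃ (q ^ (2 * r - 1))
          (w ^ (2 * (2 * r - i - m + 2 * l) - 3 : ℤ))
          (w ^ (2 * (i + m - 2 * l) + 1 : ℤ))
          (q ^ (2 * r - 1))

/-- The summand for `m = 0`, as a function of `s = (s_1, …, s_{r-1})`: the exponent of `q` is
`s_1²/2 + s_2² + ⋯ + s_{r-1}² + s_1/2 - (s_1 + ⋯ + s_i)`. -/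
def zeroTerm (q w : ℂ) (r i : ℕ) (s : Fin (r - 1) → ℤ) : ℂ :=
  w ^ (entry s 1 ^ 2 + 2 * ∑ j ∈ Finset.Icc 2 (r - 1), entry s j ^ 2
        + entry s 1 - 2 * ∑ j ∈ Finset.Icc 1 i, entry s j)
    * qPoch (-1) q (entry s 1)
    / ((∏ j ∈ Finset.Icc 1 (r - 2), qPoch q q (entry s j - entry s (j + 1)))
        * qPoch q q (entry s (r - 1)) * qPoch (-w) q (entry s (r - 1)))

end

end QSeries

open Filter Topology

namespace QSeries

/-! The proof iterates the Bailey lemma for bilateral pairs relative to q^m, where q = w²: β_n = Σ_j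
α_j / ((q)_{n-j} (q)_{m+n+j}), j running over ℤ. By the finite q-binomial theorem, α_j = (-1)^j
q^{j(j-1)/2} gives the β which carries the binomial coefficient in s_r (`hasSum_bailey_initial`).

The sums are evaluated from s_r upwards, each one reproducing the kernel and multiplying α_j by a
Gaussian factor. The sum over s_r is a step with parameters -q^{(m+1)/2} and ∞
(`hasSum_bailey_half`). The entries s_k with i < k < r and k ≥ 2 use both parameters infinite
(`hasSum_bailey_sq`). For 2 ≤ k ≤ i the extra q^{-s_k} makes the step relative to q^{m-1}; the
kernel then acquires a factor S - q^{n-j}(S-1), where S is a geometric sum in q^{m+2j} that gains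
one term per step (`hasSum_bailey_lattice`). The sum over s_1 is a limiting q-Gauss sum
(`hasSum_bailey_top`). With y = q^{(m+2j)/2} it leaves (1 + y + ⋯ + y^{2i})/(1 + y) times a Gaussian
in j.

The reflection j ↦ -m-j sends y to 1/y. Averaging over it cancels the denominator 1 + y, and the
resulting theta series are products by the Jacobi triple product identity. Absolute convergence
justifies every interchange. For m = 0 the binomial coefficient forces s_r = 0, which gives the last
identity. -/

theorem hasSum_of_eq {ι : Type*} {f g : ι → ℂ} {a b : ℂ} (h : HasSum g b) (hf : ∀ t, f t = g t)
    (ha : a = b) : HasSum f a := by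
  rw [ha]
  exact h.congr_fun hf

/-! ### Infinite q-products. -/

section Basic

variable {a q w : ℂ}

theorem summable_norm_mul_pow (a : ℂ) (hq : ‖q‖ < 1) : Summable fun j : ℕ => ‖-(a * q ^ j)‖ := by
  simp only [norm_neg, norm_mul, norm_pow]
  exact (summable_geometric_of_lt_one (norm_nonneg _) hq).mul_left _

theorem multipliable_qInf (a : ℂ) (hq : ‖q‖ < 1) : Multipliable fun j : ℕ => 1 - a * q ^ j := by
  simpa [sub_eq_add_neg] using multipliable_one_add_of_summable (summable_norm_mul_pow a hq)

theorem qInf_eq_mul (a : ℂ) (hq : ‖q‖ < 1) : qInf a q = (1 - a) * qInf (a * q) q := by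
  have h : Multipliable fun j : ℕ => 1 - a * q ^ (j + 1) := by
    simpa [pow_succ', mul_assoc] using multipliable_qInf (a * q) hq
  have h2 := tprod_eq_zero_mul' (f := fun j : ℕ => 1 - a * q ^ j) h
  simp only [pow_zero, mul_one] at h2
  rw [qInf, h2, qInf]
  simp only [pow_succ', mul_assoc]

theorem qInf_ne_zero (hq : ‖q‖ < 1) (h : ∀ j : ℕ, a * q ^ j ≠ 1) : qInf a q ≠ 0 := by
  have := tprod_one_add_ne_zero_of_summable (f := fun j : ℕ => -(a * q ^ j))
    (fun j => by simpa [← sub_eq_add_neg, sub_eq_zero] using (h j).symm)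
    (summable_norm_mul_pow a hq)
  simpa [qInf, sub_eq_add_neg] using this

theorem tendsto_prod_qInf (a : ℂ) (hq : ‖q‖ < 1) :
    Tendsto (fun n : ℕ => ∏ j ∈ Finset.range n, (1 - a * q ^ j)) atTop (𝓝 (qInf a q)) :=
  (multipliable_qInf a hq).hasProd.tendsto_prod_nat

theorem qInf_eq_prod_mul (a : ℂ) (hq : ‖q‖ < 1) (n : ℕ) :
    qInf a q = (∏ j ∈ Finset.range n, (1 - a * q ^ j)) * qInf (a * q ^ n) q := by
  induction n with
  | zero => simp
  | succ n ih =>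
    rw [ih, Finset.prod_range_succ, qInf_eq_mul (a * q ^ n) hq]
    ring_nf

theorem tendsto_qInf_mul_pow (hq : ‖q‖ < 1) (h : ∀ j : ℕ, a * q ^ j ≠ 1) :
    Tendsto (fun n : ℕ => qInf (a * q ^ n) q) atTop (𝓝 1) := by
  have h0 := qInf_ne_zero hq h
  have := (tendsto_const_nhds (x := qInf a q)).div (tendsto_prod_qInf a hq) h0
  rw [div_self h0] at this
  refine this.congr fun n => ?_
  rw [Pi.div_apply, qInf_eq_prod_mul a hq n, mul_div_cancel_left₀]
  exact Finset.prod_ne_zero_iff.mpr fun j _ => by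
    rw [sub_ne_zero]; exact (h j).symm

end Basic

/-! ### Reciprocal q-factorials and the products (-q^{n/2}; q)_∞ at integer index. -/

noncomputable section

/-- `1 / (q; q)_n` for `q = w ^ 2`, equal to `0` for negative `n`. -/
def invFact (w : ℂ) (n : ℤ) : ℂ := qInf (w ^ (2 * n + 2)) (w ^ 2) / qInf (w ^ 2) (w ^ 2)

/-- `(-q^{n/2}; q)_∞` for `q = w ^ 2`. -/
def negInf (w : ℂ) (n : ℤ) : ℂ := qInf (-w ^ n) (w ^ 2)

end

section Half

variable {w : ℂ}

theorem norm_sq_lt_one (hw : ‖w‖ < 1) : ‖w ^ 2‖ < 1 := by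
  rw [norm_pow]; exact pow_lt_one₀ (norm_nonneg _) hw two_ne_zero

theorem zpow_ne_one_of_pos (hw : ‖w‖ < 1) {n : ℤ} (hn : 0 < n) : w ^ n ≠ 1 := by
  lift n to ℕ using hn.le
  intro h
  have h2 : ‖w‖ ^ n < 1 := pow_lt_one₀ (norm_nonneg _) hw (by omega)
  rw [zpow_natCast] at h
  rw [← norm_pow, h] at h2
  simp at h2

theorem zpow_ne_one (hw : ‖w‖ < 1) {n : ℤ} (hn : n ≠ 0) : w ^ n ≠ 1 := by
  rcases lt_or_gt_of_ne hn with h | h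
  · have := zpow_ne_one_of_pos hw (n := -n) (by omega)
    rwa [zpow_neg, Ne, inv_eq_one] at this
  · exact zpow_ne_one_of_pos hw h

theorem zpow_ne_neg_one (hw : ‖w‖ < 1) (n : ℤ) : w ^ n ≠ -1 := by
  intro h
  rcases eq_or_ne n 0 with rfl | hn
  · norm_num at h
  · apply zpow_ne_one hw (n := n * 2) (by omega)
    rw [zpow_mul, h]; norm_num

theorem one_add_zpow_ne_zero (hw : ‖w‖ < 1) (n : ℤ) : 1 + w ^ n ≠ 0 := fun h =>
  zpow_ne_neg_one hw n (by linear_combination h)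

theorem zpow_mul_zpow_eq (hw0 : w ≠ 0) {a b c : ℤ} (h : a + b = c) : w ^ a * w ^ b = w ^ c := by
  rw [← zpow_add₀ hw0, h]

theorem zpow_mul_sq_pow (hw0 : w ≠ 0) (n : ℤ) (j : ℕ) : w ^ n * (w ^ 2) ^ j = w ^ (n + 2 * j) := by
  rw [zpow_add₀ hw0, zpow_mul]; norm_cast

theorem qInf_self_ne_zero (hw : ‖w‖ < 1) : qInf (w ^ 2) (w ^ 2) ≠ 0 :=
  qInf_ne_zero (norm_sq_lt_one hw) fun j => by
    have := zpow_ne_one_of_pos hw (n := 2 * (j + 1 : ℕ)) (by positivity)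
    rwa [← pow_succ', ← pow_mul, ← zpow_natCast, Nat.cast_mul]

theorem negInf_ne_zero (hw0 : w ≠ 0) (hw : ‖w‖ < 1) (n : ℤ) : negInf w n ≠ 0 :=
  qInf_ne_zero (norm_sq_lt_one hw) fun j => by
    rw [neg_mul, zpow_mul_sq_pow hw0]
    intro h
    exact zpow_ne_neg_one hw _ (by rw [← h, neg_neg])

theorem negInf_eq_mul (hw0 : w ≠ 0) (hw : ‖w‖ < 1) (n : ℤ) :
    negInf w n = (1 + w ^ n) * negInf w (n + 2) := by
  have := zpow_mul_sq_pow hw0 n 1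
  rw [negInf, qInf_eq_mul _ (norm_sq_lt_one hw), negInf]
  simp only [pow_one, Nat.cast_one, mul_one] at this
  rw [neg_mul, this, sub_neg_eq_add]

theorem tendsto_negInf (hw0 : w ≠ 0) (hw : ‖w‖ < 1) (n : ℤ) :
    Tendsto (fun N : ℕ => negInf w (n + 2 * N)) atTop (𝓝 1) := by
  refine (tendsto_qInf_mul_pow (a := -w ^ n) (norm_sq_lt_one hw) fun j => ?_).congr fun N => ?_
  · rw [neg_mul, zpow_mul_sq_pow hw0]
    intro h
    exact zpow_ne_neg_one hw _ (by rw [← h, neg_neg])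
  · rw [negInf, neg_mul, zpow_mul_sq_pow hw0]

/-- Valid for every integer n: at n = 0 it gives 1/(q)_{-1} = 0, and the zeros propagate downwards.
Sums can therefore run over all of ℤ without boundary terms. -/
theorem invFact_sub_one (hw0 : w ≠ 0) (hw : ‖w‖ < 1) (n : ℤ) :
    invFact w (n - 1) = (1 - w ^ (2 * n)) * invFact w n := by
  have := zpow_mul_sq_pow hw0 (2 * n) 1
  simp only [pow_one, Nat.cast_one, mul_one] at this
  rw [invFact, invFact, show 2 * (n - 1) + 2 = 2 * n by ring, qInf_eq_mul _ (norm_sq_lt_one hw),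
    this, mul_div_assoc]

theorem invFact_zero (hw : ‖w‖ < 1) : invFact w 0 = 1 := by
  simpa [invFact] using div_self (qInf_self_ne_zero hw)

theorem invFact_of_neg (hw0 : w ≠ 0) (hw : ‖w‖ < 1) {n : ℤ} (hn : n < 0) : invFact w n = 0 := by
  obtain ⟨k, rfl⟩ : ∃ k : ℕ, n = -1 - k := ⟨(-1 - n).toNat, by omega⟩
  clear hn
  induction k with
  | zero => have := invFact_sub_one hw0 hw 0; simpa using this
  | succ k ih =>
    have := invFact_sub_one hw0 hw (-1 - k)
    rw [ih, mul_zero] at this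
    rw [← this]; congr 1; push_cast; ring

theorem invFact_ne_zero (hw0 : w ≠ 0) (hw : ‖w‖ < 1) {n : ℤ} (hn : 0 ≤ n) : invFact w n ≠ 0 :=
  div_ne_zero (qInf_ne_zero (norm_sq_lt_one hw) fun j => by
    rw [zpow_mul_sq_pow hw0]
    exact zpow_ne_one_of_pos hw (by omega)) (qInf_self_ne_zero hw)

theorem tendsto_invFact (hw0 : w ≠ 0) (hw : ‖w‖ < 1) :
    Tendsto (fun N : ℕ => invFact w N) atTop (𝓝 (qInf (w ^ 2) (w ^ 2))⁻¹) := by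
  have := (tendsto_qInf_mul_pow (a := w ^ (2 : ℤ)) (norm_sq_lt_one hw) fun j => by
    rw [zpow_mul_sq_pow hw0]
    exact zpow_ne_one_of_pos hw (by omega)).div_const (qInf (w ^ 2) (w ^ 2))
  rw [one_div] at this
  refine this.congr fun N => ?_
  rw [invFact, zpow_mul_sq_pow hw0, add_comm]

theorem tendsto_invFact_sub (hw0 : w ≠ 0) (hw : ‖w‖ < 1) (t : ℤ) :
    Tendsto (fun N : ℕ => invFact w (N + t)) atTop (𝓝 (qInf (w ^ 2) (w ^ 2))⁻¹) := by
  have h1 : Tendsto (fun N : ℕ => ((N : ℤ) + t).toNat) atTop atTop :=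
    tendsto_atTop.mpr fun b => by
      filter_upwards [eventually_ge_atTop (b + t.natAbs)] with N hN
      omega
  refine ((tendsto_invFact hw0 hw).comp h1).congr' ?_
  filter_upwards [eventually_ge_atTop t.natAbs] with N hN
  rw [Function.comp_apply, Int.toNat_of_nonneg (by omega)]

theorem exists_norm_invFact_le (hw0 : w ≠ 0) (hw : ‖w‖ < 1) : ∃ C, 0 ≤ C ∧ ∀ n, ‖invFact w n‖ ≤ C := by
  obtain ⟨C, hC⟩ := (Metric.isBounded_range_of_tendsto _ (tendsto_invFact hw0 hw)).exists_norm_le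
  have h0 : 0 ≤ C := (norm_nonneg _).trans (hC _ ⟨0, rfl⟩)
  refine ⟨C, h0, fun n => ?_⟩
  rcases lt_or_ge n 0 with h | h
  · rw [invFact_of_neg hw0 hw h, norm_zero]; exact h0
  · lift n to ℕ using h
    exact hC _ ⟨n, rfl⟩

/-- Both sequences converge to 1 as t → ∞, hence are bounded; only indices bounded below are
covered. -/
theorem exists_norm_negInf_le (hw0 : w ≠ 0) (hw : ‖w‖ < 1) (n t₀ : ℤ) :
    ∃ C, 0 ≤ C ∧ ∀ t, t₀ ≤ t → ‖negInf w (n + 2 * t)‖ ≤ C ∧ ‖(negInf w (n + 2 * t))⁻¹‖ ≤ C := by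
  have h1 := tendsto_negInf hw0 hw (n + 2 * t₀)
  obtain ⟨C, hC⟩ := (Metric.isBounded_range_of_tendsto _ h1).exists_norm_le
  obtain ⟨D, hD⟩ :=
    (Metric.isBounded_range_of_tendsto _ (h1.inv₀ one_ne_zero)).exists_norm_le
  refine ⟨max C D, ((norm_nonneg _).trans (hC _ ⟨0, rfl⟩)).trans (le_max_left _ _), fun t ht => ?_⟩
  obtain ⟨k, rfl⟩ : ∃ k : ℕ, t = t₀ + k := ⟨(t - t₀).toNat, by omega⟩
  rw [show n + 2 * (t₀ + k) = n + 2 * t₀ + 2 * (k : ℤ) by ring]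
  exact ⟨(hC _ ⟨k, rfl⟩).trans (le_max_left _ _), (hD _ ⟨k, rfl⟩).trans (le_max_right _ _)⟩

end Half

/-! ### Terminating q-hypergeometric sums. -/

section Conv

variable {w : ℂ}

/-- The q-Pascal rule: 1 - q^N = (1 - q^{N-t}) + q^{N-t}(1 - q^t) splits the sum into two sums for N
- 1, the second shifted by one. It is the common induction step of the summations below. -/
theorem hasSum_conv_step (hw0 : w ≠ 0) (hw : ‖w‖ < 1) {N : ℤ} (hN : 0 < N) {f g : ℤ → ℂ}
    {S S₁ S₂ : ℂ} (h₁ : HasSum (fun t => invFact w t * invFact w (N - 1 - t) * f t) S₁)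
    (h₂ : HasSum (fun t => invFact w t * invFact w (N - 1 - t) * g t) S₂)
    (hg : ∀ t, f (t + 1) = w ^ (2 * t) * g t)
    (hS : (1 - w ^ (2 * N)) * S = S₁ + w ^ (2 * N - 2) * S₂) :
    HasSum (fun t => invFact w t * invFact w (N - t) * f t) S := by
  have hne : 1 - w ^ (2 * N) ≠ 0 :=
    sub_ne_zero.mpr (zpow_ne_one_of_pos hw (by omega)).symm
  have h₃ := (h₁.add (((Equiv.subRight (1 : ℤ)).hasSum_iff.mpr h₂).mul_left
    (w ^ (2 * N - 2)))).div_const (1 - w ^ (2 * N))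
  rw [← hS, mul_div_cancel_left₀ _ hne] at h₃
  refine h₃.congr_fun fun t => ?_
  rw [eq_div_iff hne]
  have hf := hg (t - 1)
  have e1 := invFact_sub_one hw0 hw (N - t)
  have e2 := invFact_sub_one hw0 hw t
  rw [sub_add_cancel] at hf
  rw [show N - t - 1 = N - 1 - t by ring] at e1
  simp only [Function.comp_apply, Equiv.subRight_apply]
  rw [show N - 1 - (t - 1) = N - t by ring, e1, e2, hf]
  have p1 := zpow_mul_zpow_eq hw0 (show 2 * (N - t) + 2 * (t - 1) = 2 * N - 2 by ring)
  have p2 := zpow_mul_zpow_eq hw0 (show (2 * N - 2) + 2 * t = 2 * N + 2 * (t - 1) by ring)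
  have p3 := zpow_mul_zpow_eq hw0 (show 2 * N + 2 * (t - 1) = 2 * N + 2 * (t - 1) by ring)
  linear_combination (invFact w t * invFact w (N - t) * g (t - 1)) * (p2 + p1 - p3)

theorem hasSum_conv_zero (hw0 : w ≠ 0) (hw : ‖w‖ < 1) {N : ℤ} (hN : N = 0) {f : ℤ → ℂ} {S : ℂ}
    (hS : S = f 0) : HasSum (fun t => invFact w t * invFact w (N - t) * f t) S := by
  subst hN
  convert hasSum_single (f := fun t => invFact w t * invFact w (0 - t) * f t) 0 ?_ using 1
  · simp [invFact_zero hw, hS]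
  · intro t ht
    rcases lt_or_gt_of_ne ht with h | h
    · simp [invFact_of_neg hw0 hw h]
    · simp [invFact_of_neg hw0 hw (show -t < 0 by omega)]

theorem hasSum_conv_neg (hw0 : w ≠ 0) (hw : ‖w‖ < 1) {N : ℤ} (hN : N < 0) (f : ℤ → ℂ) :
    HasSum (fun t => invFact w t * invFact w (N - t) * f t) 0 := by
  convert hasSum_zero (α := ℂ) (β := ℤ) using 2 with t
  rcases lt_or_ge t 0 with h | h
  · simp [invFact_of_neg hw0 hw h]
  · simp [invFact_of_neg hw0 hw (show N - t < 0 by omega)]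

/-- The `q`-Chu–Vandermonde sum behind the Bailey lemma with both parameters infinite. -/
theorem hasSum_conv_sq (hw0 : w ≠ 0) (hw : ‖w‖ < 1) (N L : ℤ) :
    HasSum (fun t => invFact w t * invFact w (N - t) * (w ^ (2 * t ^ 2 + 2 * L * t) *
      invFact w (t + L))) (invFact w N * invFact w (N + L)) := by
  rcases lt_or_ge N 0 with hN | hN
  · rw [invFact_of_neg hw0 hw hN, zero_mul]
    exact hasSum_conv_neg hw0 hw hN _
  lift N to ℕ using hN
  induction N generalizing L with
  | zero =>
    refine hasSum_conv_zero hw0 hw Nat.cast_zero ?_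
    simp [invFact_zero hw]
  | succ N ih =>
    -- The shifted half of the Pascal rule is the same sum with L + 1 in place of L.
    have h₁ := ih L
    have h₂ := (ih (L + 1)).mul_left (w ^ (2 * L + 2))
    rw [show (N : ℤ) = (N + 1 : ℕ) - 1 by push_cast; ring] at h₁ h₂
    refine hasSum_conv_step hw0 hw (by positivity) h₁
      (g := fun t => w ^ (2 * L + 2) * (w ^ (2 * t ^ 2 + 2 * (L + 1) * t) * invFact w (t + (L + 1))))
      (h₂.congr_fun fun t => by ring) (fun t => ?_) ?_
    · rw [← mul_assoc, ← mul_assoc, zpow_mul_zpow_eq hw0 rfl, zpow_mul_zpow_eq hw0 rfl]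
      congr 2 <;> ring
    · have e1 := invFact_sub_one hw0 hw (N + 1 : ℕ)
      have e2 := invFact_sub_one hw0 hw ((N + 1 : ℕ) + L)
      rw [e1, show ((N + 1 : ℕ) : ℤ) - 1 + L = (N + 1 : ℕ) + L - 1 by ring, e2,
        show ((N + 1 : ℕ) : ℤ) - 1 + (L + 1) = (N + 1 : ℕ) + L by ring]
      have p := zpow_mul_zpow_eq hw0 (show (2 * ((N + 1 : ℕ) : ℤ) - 2) + (2 * L + 2) =
        2 * ((N + 1 : ℕ) + L) by ring)
      linear_combination (-(1 - w ^ (2 * ((N + 1 : ℕ) : ℤ))) * invFact w (N + 1 : ℕ) *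
        invFact w ((N + 1 : ℕ) + L)) * p

/-- The extra q^{-t} is removed by q^{-t} = 1 + q^{-t}(1 - q^t): the factor 1 - q^t lowers (q)_t,
and a shift of t gives the sum for N - 1, L + 1. -/
theorem hasSum_conv_sq_sub (hw0 : w ≠ 0) (hw : ‖w‖ < 1) (N L : ℤ) :
    HasSum (fun t => invFact w t * invFact w (N - t) * (w ^ (2 * t ^ 2 + 2 * (L - 1) * t) *
      invFact w (t + L)))
      (invFact w N * invFact w (N + L) * (1 + w ^ (2 * L) - w ^ (2 * (N + L)))) := by
  have h₁ := hasSum_conv_sq hw0 hw N L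
  have h₂ := ((Equiv.subRight (1 : ℤ)).hasSum_iff.mpr
    (hasSum_conv_sq hw0 hw (N - 1) (L + 1))).mul_left (w ^ (2 * L))
  refine hasSum_of_eq (h₁.add h₂) (fun t => ?_) ?_
  · simp only [Function.comp_apply, Equiv.subRight_apply]
    rw [show N - 1 - (t - 1) = N - t by ring, show t - 1 + (L + 1) = t + L by ring,
      invFact_sub_one hw0 hw t]
    have p1 := zpow_mul_zpow_eq hw0 (show 2 * t + (2 * t ^ 2 + 2 * (L - 1) * t) =
      2 * t ^ 2 + 2 * L * t by ring)
    have p2 := zpow_mul_zpow_eq hw0 (show 2 * L + (2 * (t - 1) ^ 2 + 2 * (L + 1) * (t - 1)) =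
      2 * t ^ 2 + 2 * (L - 1) * t by ring)
    linear_combination invFact w t * invFact w (N - t) * invFact w (t + L) *
      (p1 - (1 - w ^ (2 * t)) * p2)
  · rw [show N - 1 + (L + 1) = N + L by ring, invFact_sub_one hw0 hw N]
    have p1 := zpow_mul_zpow_eq hw0 (show 2 * L + 2 * N = 2 * (N + L) by ring)
    linear_combination invFact w N * invFact w (N + L) * p1

/-- The terminating `q`-Gauss type sum behind the Bailey lemma with one infinite parameter. -/
theorem hasSum_conv_half (hw0 : w ≠ 0) (hw : ‖w‖ < 1) {N : ℤ} (hN : 0 ≤ N) {L b d : ℤ}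
    (hbd : b + d = 2 * L + 2) :
    HasSum (fun t => invFact w t * invFact w (N - t) * (w ^ (t ^ 2 - t + d * t) *
      invFact w (t + L) / negInf w (b + 2 * t)))
      (invFact w N * invFact w (N + L) * negInf w d / (negInf w (d + 2 * N) * negInf w b)) := by
  lift N to ℕ using hN
  induction N generalizing L b with
  | zero =>
    have := negInf_ne_zero hw0 hw d
    refine hasSum_conv_zero hw0 hw Nat.cast_zero ?_
    simp [invFact_zero hw]
    field_simp
  | succ N ih =>
    have h₁ := ih hbd
    -- The shift raises b by 2 and L by 1; d stays fixed, so the balancing condition survives.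
    have h₂ := (ih (show (b + 2) + d = 2 * (L + 1) + 2 by linarith)).mul_left (w ^ d)
    rw [show (N : ℤ) = (N + 1 : ℕ) - 1 by push_cast; ring] at h₁ h₂
    refine hasSum_conv_step hw0 hw (by positivity) h₁
      (g := fun t => w ^ d * (w ^ (t ^ 2 - t + d * t) * invFact w (t + (L + 1)) /
        negInf w (b + 2 + 2 * t)))
      (h₂.congr_fun fun t => by ring) (fun t => ?_) ?_
    · rw [← mul_div_assoc, ← mul_div_assoc, ← mul_assoc, ← mul_assoc, zpow_mul_zpow_eq hw0 rfl,
        zpow_mul_zpow_eq hw0 rfl, show b + 2 * (t + 1) = b + 2 + 2 * t by ring]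
      congr 3 <;> ring
    · have e1 := invFact_sub_one hw0 hw (N + 1 : ℕ)
      have e2 := invFact_sub_one hw0 hw ((N + 1 : ℕ) + L)
      have e3 := negInf_eq_mul hw0 hw b
      have e4 := negInf_eq_mul hw0 hw (d + 2 * ((N + 1 : ℕ) - 1))
      have n1 := negInf_ne_zero hw0 hw (b + 2)
      have n2 := negInf_ne_zero hw0 hw (d + 2 * (N + 1 : ℕ))
      have n3 := one_add_zpow_ne_zero hw b
      have n4 := one_add_zpow_ne_zero hw (d + 2 * ((N + 1 : ℕ) - 1))
      rw [show d + 2 * (((N + 1 : ℕ) : ℤ) - 1) + 2 = d + 2 * (N + 1 : ℕ) by ring] at e4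
      rw [e1, show ((N + 1 : ℕ) : ℤ) - 1 + L = (N + 1 : ℕ) + L - 1 by ring, e2,
        show ((N + 1 : ℕ) : ℤ) - 1 + (L + 1) = (N + 1 : ℕ) + L by ring, e3, e4]
      have p := zpow_mul_zpow_eq hw0 (show (2 * ((N + 1 : ℕ) : ℤ) - 2) + d =
        d + 2 * ((N + 1 : ℕ) - 1) by ring)
      -- After cancellation the claim is 1 + X = (1 - Y) + X(1 + w^b), with X and Y as generalized
      -- below; the balancing condition says exactly Y = X w^b.
      have p2 := zpow_mul_zpow_eq hw0 (show (d + 2 * (((N + 1 : ℕ) : ℤ) - 1)) + b =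
        2 * ((N + 1 : ℕ) + L) by linarith)
      rw [mul_left_comm, mul_div_assoc, mul_div_assoc]
      generalize w ^ (d + 2 * (((N + 1 : ℕ) : ℤ) - 1)) = X at *
      generalize w ^ (2 * (((N + 1 : ℕ) : ℤ) + L)) = Y at *
      generalize negInf w (d + 2 * (N + 1 : ℕ)) = Z at *
      generalize invFact w ((N + 1 : ℕ) + L) = U at *
      generalize invFact w (N + 1 : ℕ) = V at *
      rw [← p2]
      field_simp
      rw [← p]
      ring

/-- The finite `q`-binomial theorem. -/
theorem hasSum_conv_binomial (hw0 : w ≠ 0) (hw : ‖w‖ < 1) (N : ℕ) {z : ℂ} (hz : z ≠ 0) :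
    HasSum (fun t => invFact w t * invFact w (N - t) * ((-z) ^ t * w ^ (t ^ 2 - t)))
      (invFact w N * ∏ u ∈ Finset.range N, (1 - z * (w ^ 2) ^ u)) := by
  induction N with
  | zero =>
    refine hasSum_conv_zero hw0 hw Nat.cast_zero ?_
    simp [invFact_zero hw]
  | succ N ih =>
    have h₁ := ih
    have h₂ := ih.mul_left (-z)
    rw [show (N : ℤ) = (N + 1 : ℕ) - 1 by push_cast; ring] at h₁ h₂
    refine hasSum_conv_step hw0 hw (by positivity) h₁
      (g := fun t => (-z) * ((-z) ^ t * w ^ (t ^ 2 - t)))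
      (h₂.congr_fun fun t => by ring) (fun t => ?_) ?_
    · rw [zpow_add₀ (neg_ne_zero.mpr hz), zpow_one]
      have := zpow_mul_zpow_eq hw0 (show 2 * t + (t ^ 2 - t) = (t + 1) ^ 2 - (t + 1) by ring)
      rw [← this]
      ring
    · have e1 := invFact_sub_one hw0 hw (N + 1 : ℕ)
      rw [e1, Finset.prod_range_succ]
      have p : w ^ (2 * ((N + 1 : ℕ) : ℤ) - 2) = (w ^ 2) ^ N := by
        rw [← pow_mul, ← zpow_natCast]; congr 1; push_cast; ring
      rw [p]
      ring

end Conv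

/-! ### Limits N → ∞ and the Jacobi triple product. -/

section Limits

variable {w : ℂ}

theorem summable_int_pow_natAbs {x : ℝ} (h0 : 0 ≤ x) (h1 : x < 1) :
    Summable fun t : ℤ => x ^ t.natAbs := by
  rw [summable_int_iff_summable_nat_and_neg]
  constructor <;> simpa using summable_geometric_of_lt_one h0 h1

theorem summable_norm_zpow_quadratic (hw0 : w ≠ 0) (hw : ‖w‖ < 1) {a : ℤ} (ha : 0 < a) (b : ℤ) :
    Summable fun t : ℤ => ‖w ^ (a * t ^ 2 + b * t)‖ := by
  have hpos : 0 < ‖w‖ := norm_pos_iff.mpr hw0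
  refine Summable.of_nonneg_of_le (fun _ => norm_nonneg _) (fun t => ?_)
    ((summable_int_pow_natAbs hpos.le hw).mul_left (‖w‖ ^ (-(|b| + 1) ^ 2)))
  rw [norm_zpow, ← zpow_natCast, ← zpow_add₀ hpos.ne', Int.natCast_natAbs]
  -- The constant comes from x² - cx + c² ≥ 0 with x = |t|, c = |b| + 1, which gives at² + bt ≥ |t|
  -- - c².
  refine zpow_le_zpow_right_of_le_one₀ hpos hw.le ?_
  have h1 : -(|b| * |t|) ≤ b * t := by rw [← abs_mul]; exact neg_abs_le _
  have h2 : |t| ^ 2 ≤ a * t ^ 2 := by rw [sq_abs]; nlinarith [sq_nonneg t]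
  nlinarith [abs_nonneg b, abs_nonneg t, sq_nonneg (|t| - (|b| + 1))]

/-- Dominated convergence: 1/(q)_{N-t} is uniformly bounded and tends to 1/(q)_∞, a nonzero factor
that cancels from both sides. -/
theorem hasSum_of_tendsto_conv (hw0 : w ≠ 0) (hw : ‖w‖ < 1) {f : ℤ → ℂ} {S : ℕ → ℂ} {S' : ℂ}
    (hf : Summable fun t => ‖invFact w t * f t‖)
    (h : ∀ N : ℕ, HasSum (fun t => invFact w t * invFact w (N - t) * f t) (S N))
    (hS : Tendsto S atTop (𝓝 ((qInf (w ^ 2) (w ^ 2))⁻¹ * S'))) :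
    HasSum (fun t => invFact w t * f t) S' := by
  obtain ⟨C, -, hC⟩ := exists_norm_invFact_le hw0 hw
  have h1 := tendsto_tsum_of_dominated_convergence (𝓕 := atTop)
    (f := fun (N : ℕ) (t : ℤ) => invFact w t * invFact w (N - t) * f t)
    (g := fun t => (qInf (w ^ 2) (w ^ 2))⁻¹ * (invFact w t * f t))
    (bound := fun t => C * ‖invFact w t * f t‖) (hf.mul_left C)
    (fun t => by
      have := (tendsto_invFact_sub hw0 hw (-t)).mul_const (invFact w t * f t)
      exact this.congr fun N => by rw [← sub_eq_add_neg]; ring)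
    (Eventually.of_forall fun N t => by
      rw [mul_comm (invFact w t), mul_assoc, norm_mul]
      exact mul_le_mul_of_nonneg_right (hC _) (norm_nonneg _))
  simp only [(h _).tsum_eq] at h1
  have h2 := tendsto_nhds_unique hS h1
  rw [tsum_mul_left, mul_right_inj' (inv_ne_zero (qInf_self_ne_zero hw))] at h2
  rw [h2]
  exact hf.of_norm.hasSum

theorem hasSum_half (hw0 : w ≠ 0) (hw : ‖w‖ < 1) {L b d : ℤ} (hbd : b + d = 2 * L + 2) :
    HasSum (fun t => invFact w t * (w ^ (t ^ 2 - t + d * t) *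
      invFact w (t + L) / negInf w (b + 2 * t)))
      ((qInf (w ^ 2) (w ^ 2))⁻¹ * negInf w d / negInf w b) := by
  refine hasSum_of_tendsto_conv hw0 hw ?_
    (fun N => hasSum_conv_half hw0 hw (Int.natCast_nonneg N) hbd) ?_
  · obtain ⟨C, hC0, hC⟩ := exists_norm_invFact_le hw0 hw
    obtain ⟨D, hD0, hD⟩ := exists_norm_negInf_le hw0 hw b 0
    refine Summable.of_nonneg_of_le (fun _ => norm_nonneg _) (fun t => ?_)
      ((summable_norm_zpow_quadratic hw0 hw one_pos (d - 1)).mul_left (C * C * D))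
    rcases lt_or_ge t 0 with ht | ht
    · rw [invFact_of_neg hw0 hw ht, zero_mul, norm_zero]
      positivity
    · rw [div_eq_mul_inv, norm_mul, norm_mul, norm_mul,
        show t ^ 2 - t + d * t = 1 * t ^ 2 + (d - 1) * t by ring]
      have := mul_le_mul (mul_le_mul (hC t) (hC (t + L)) (norm_nonneg _) hC0) (hD t ht).2
        (norm_nonneg _) (by positivity)
      calc _ = ‖invFact w t‖ * ‖invFact w (t + L)‖ * ‖(negInf w (b + 2 * t))⁻¹‖ *
            ‖w ^ (1 * t ^ 2 + (d - 1) * t)‖ := by ring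
        _ ≤ _ := mul_le_mul_of_nonneg_right this (norm_nonneg _)
  · have h1 := ((tendsto_invFact hw0 hw).mul (tendsto_invFact_sub hw0 hw L)).mul_const (negInf w d)
    have h2 := (tendsto_negInf hw0 hw d).mul_const (negInf w b)
    have h3 := h1.div h2 (by simpa using negInf_ne_zero hw0 hw b)
    rw [one_mul] at h3
    rw [← mul_div_assoc, ← mul_assoc]
    exact h3

/-- With b = L and d = L + 2 the two infinite products telescope to a single factor. -/
theorem hasSum_top_succ (hw0 : w ≠ 0) (hw : ‖w‖ < 1) (L : ℤ) :
    HasSum (fun t => w ^ (t ^ 2 + (L + 1) * t) / negInf w (L + 2 * t) *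
      (invFact w t * invFact w (t + L))) ((qInf (w ^ 2) (w ^ 2))⁻¹ / (1 + w ^ L)) := by
  convert hasSum_half hw0 hw (show L + (L + 2) = 2 * L + 2 by ring) using 1
  · funext t
    rw [show t ^ 2 - t + (L + 2) * t = t ^ 2 + (L + 1) * t by ring]
    ring
  · have h1 := negInf_ne_zero hw0 hw (L + 2)
    have h2 := one_add_zpow_ne_zero hw L
    rw [negInf_eq_mul hw0 hw L]
    field_simp

/-- Same splitting as in `hasSum_conv_sq_sub`; the shifted part has b = d = L + 2, so its products
cancel entirely. -/
theorem hasSum_top (hw0 : w ≠ 0) (hw : ‖w‖ < 1) (L : ℤ) :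
    HasSum (fun t => w ^ (t ^ 2 + (L - 1) * t) / negInf w (L + 2 * t) *
      (invFact w t * invFact w (t + L)))
      ((qInf (w ^ 2) (w ^ 2))⁻¹ * (w ^ L + 1 / (1 + w ^ L))) := by
  have h₁ := ((Equiv.subRight (1 : ℤ)).hasSum_iff.mpr
    (hasSum_half hw0 hw (show (L + 2) + (L + 2) = 2 * (L + 1) + 2 by ring))).mul_left (w ^ L)
  refine hasSum_of_eq (h₁.add (hasSum_top_succ hw0 hw L)) (fun t => ?_) ?_
  · simp only [Function.comp_apply, Equiv.subRight_apply]
    rw [invFact_sub_one hw0 hw t, show t - 1 + (L + 1) = t + L by ring,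
      show L + 2 + 2 * (t - 1) = L + 2 * t by ring]
    have p1 := zpow_mul_zpow_eq hw0 (show L + ((t - 1) ^ 2 - (t - 1) + (L + 2) * (t - 1)) =
      t ^ 2 + (L - 1) * t by ring)
    have p2 := zpow_mul_zpow_eq hw0 (show 2 * t + (t ^ 2 + (L - 1) * t) =
      t ^ 2 + (L + 1) * t by ring)
    rw [← p2, ← p1]
    ring
  · rw [mul_div_cancel_right₀ _ (negInf_ne_zero hw0 hw _)]
    ring

/-- Each factor is rewritten by 1 - x = -x(1 - 1/x) and the order of the factors is reversed. -/
theorem prod_reflect_zpow (hw0 : w ≠ 0) (a e : ℤ) (n : ℕ) :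
    ∏ u ∈ Finset.range n, (1 - w ^ (e + a * (1 - 2 * n)) * w ^ (2 * a * u)) =
      (-1) ^ n * w ^ (e * n - a * n ^ 2) *
        ∏ u ∈ Finset.range n, (1 - w ^ (a - e) * w ^ (2 * a * u)) := by
  have h : ∀ k : ℕ, (-1 : ℂ) ^ k * w ^ (e * k - a * k ^ 2) =
      ∏ u ∈ Finset.range k, -w ^ (e - a - 2 * a * u) := by
    intro k
    induction k with
    | zero => simp
    | succ k ih =>
      rw [Finset.prod_range_succ, ← ih, pow_succ, ← zpow_mul_zpow_eq hw0 (show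
        (e * k - a * k ^ 2) + (e - a - 2 * a * k) = e * (k + 1 : ℕ) - a * (k + 1 : ℕ) ^ 2 by
          push_cast; ring)]
      ring
  rw [h, ← Finset.prod_mul_distrib, ← Finset.prod_range_reflect]
  refine Finset.prod_congr rfl fun u hu => ?_
  have hu' : u < n := Finset.mem_range.mp hu
  have e1 : ((n - 1 - u : ℕ) : ℤ) = n - 1 - u := by omega
  rw [e1, zpow_mul_zpow_eq hw0 (show e + a * (1 - 2 * n) + 2 * a * (n - 1 - u) =
    e - a - 2 * a * u by ring)]
  have p := zpow_mul_zpow_eq hw0 (show e - a - 2 * a * u + (a - e) = -(2 * a * u) by ring)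
  have p2 := zpow_mul_zpow_eq hw0 (show -(2 * a * u) + 2 * a * u = 0 by ring)
  rw [zpow_zero, ← p] at p2
  linear_combination -p2

/-- The Jacobi triple product identity, with base `w ^ (2 * a)` and argument `w ^ e`. -/
theorem hasSum_jacobi_triple (hw0 : w ≠ 0) (hw : ‖w‖ < 1) {a : ℕ} (ha : 0 < a) (e : ℤ) :
    HasSum (fun j : ℤ => (-1) ^ j * w ^ (a * j ^ 2 + e * j))
      (qInf₃ (w ^ (2 * a)) (w ^ (a + e)) (w ^ (a - e)) (w ^ (2 * a))) := by
  have hv0 : w ^ a ≠ 0 := pow_ne_zero _ hw0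
  have hv : ‖w ^ a‖ < 1 := by rw [norm_pow]; exact pow_lt_one₀ (norm_nonneg _) hw ha.ne'
  have hvv : (w ^ a) ^ 2 = w ^ (2 * a) := by rw [← pow_mul, mul_comm]
  have hq : ‖w ^ (2 * a)‖ < 1 := hvv ▸ norm_sq_lt_one hv
  have hsum : Summable fun j : ℤ => ‖(-1) ^ j * w ^ (a * j ^ 2 + e * j)‖ := by
    refine (summable_norm_zpow_quadratic hw0 hw (a := a) (by exact_mod_cast ha) e).congr fun j => ?_
    rw [norm_mul, norm_zpow (-1 : ℂ)]
    simp
  have hzpow : ∀ u : ℕ, (w ^ (2 * a)) ^ u = w ^ (2 * (a : ℤ) * u) := fun u => by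
    rw [← pow_mul, ← zpow_natCast]; push_cast; rfl
  have hfin : ∀ n : ℕ, HasSum (fun j : ℤ => invFact (w ^ a) (n + j) * invFact (w ^ a) (n - j) *
      ((-1) ^ j * w ^ (a * j ^ 2 + e * j)))
      (invFact (w ^ a) (2 * n : ℕ) *
        ((∏ u ∈ Finset.range n, (1 - w ^ (a - e) * (w ^ (2 * a)) ^ u)) *
          ∏ u ∈ Finset.range n, (1 - w ^ (a + e) * (w ^ (2 * a)) ^ u))) := by
    intro n
    -- The q-binomial theorem of order 2n, recentred by t = n + j. The argument is chosen so that
    -- the first n factors reflect to one half of the product and the last n are the other half.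
    have h := ((Equiv.addLeft (n : ℤ)).hasSum_iff.mpr (hasSum_conv_binomial hv0 hv (2 * n)
      (zpow_ne_zero (e + a * (1 - 2 * n)) hw0))).mul_left ((-1) ^ n * w ^ (a * n ^ 2 - e * n : ℤ))
    have hinv := zpow_mul_zpow_eq hw0 (show (a * n ^ 2 - e * n : ℤ) + (e * n - a * n ^ 2) = 0 by ring)
    have hsgn : ((-1 : ℂ) ^ n) * (-1) ^ n = 1 := by rw [← mul_pow]; simp
    refine hasSum_of_eq h (fun j => ?_) ?_
    · simp only [Function.comp_apply, Equiv.coe_addLeft]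
      rw [neg_eq_neg_one_mul (w ^ _), mul_zpow, zpow_add₀ (show (-1 : ℂ) ≠ 0 by norm_num), zpow_natCast,
        ← zpow_mul, ← zpow_natCast w a, ← zpow_mul,
        show (((2 * n : ℕ) : ℤ) - (n + j)) = n - j by push_cast; ring]
      have p : w ^ (a * n ^ 2 - e * n : ℤ) * (w ^ ((e + a * (1 - 2 * n)) * (n + j)) *
          w ^ (a * ((n + j) ^ 2 - (n + j)))) = w ^ (a * j ^ 2 + e * j) := by
        rw [zpow_mul_zpow_eq hw0 rfl]
        exact zpow_mul_zpow_eq hw0 (by ring)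
      rw [← p]
      linear_combination (-(invFact (w ^ (a : ℤ)) (n + j)) * invFact (w ^ (a : ℤ)) (n - j) * (-1) ^ j *
        (w ^ (a * n ^ 2 - e * n : ℤ) * (w ^ ((e + a * (1 - 2 * n)) * (n + j)) *
          w ^ (a * ((n + j) ^ 2 - (n + j))))) : ℂ) * hsgn
    · rw [two_mul n, Finset.prod_range_add, hvv]
      simp only [hzpow]
      rw [prod_reflect_zpow hw0 a e n]
      have h2 : ∏ x ∈ Finset.range n, (1 - w ^ (e + a * (1 - 2 * n)) * w ^ (2 * (a : ℤ) * (n + x : ℕ))) =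
          ∏ u ∈ Finset.range n, (1 - w ^ ((a : ℤ) + e) * w ^ (2 * (a : ℤ) * u)) :=
        Finset.prod_congr rfl fun u _ => by
          rw [zpow_mul_zpow_eq hw0 rfl, zpow_mul_zpow_eq hw0 rfl]
          congr 2
          push_cast
          ring
      rw [h2]
      rw [zpow_zero] at hinv
      generalize w ^ (a * n ^ 2 - e * n : ℤ) = X at *
      generalize w ^ (e * n - a * n ^ 2 : ℤ) = Y at *
      generalize ∏ u ∈ Finset.range n, (1 - w ^ ((a : ℤ) + e) * w ^ (2 * (a : ℤ) * u)) = A at *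
      generalize ∏ u ∈ Finset.range n, (1 - w ^ ((a : ℤ) - e) * w ^ (2 * (a : ℤ) * u)) = B at *
      generalize invFact (w ^ a) (n + n : ℕ) = D
      linear_combination (-(D * B * A) * (X * Y)) * hsgn - D * B * A * hinv
  have hE := qInf_self_ne_zero hv
  obtain ⟨C, hC0, hC⟩ := exists_norm_invFact_le hv0 hv
  have h1 := tendsto_tsum_of_dominated_convergence (𝓕 := atTop)
    (f := fun (n : ℕ) (j : ℤ) => invFact (w ^ a) (n + j) * invFact (w ^ a) (n - j) *
      ((-1) ^ j * w ^ (a * j ^ 2 + e * j)))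
    (g := fun j => (qInf ((w ^ a) ^ 2) ((w ^ a) ^ 2))⁻¹ * (qInf ((w ^ a) ^ 2) ((w ^ a) ^ 2))⁻¹ *
      ((-1) ^ j * w ^ (a * j ^ 2 + e * j)))
    (bound := fun j => C * C * ‖(-1) ^ j * w ^ (a * j ^ 2 + e * j)‖) (hsum.mul_left _)
    (fun j => by
      have h3 := tendsto_invFact_sub hv0 hv (-j)
      simp only [← sub_eq_add_neg] at h3
      exact ((tendsto_invFact_sub hv0 hv j).mul h3).mul_const _)
    (Eventually.of_forall fun n j => by
      rw [norm_mul, norm_mul]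
      exact mul_le_mul_of_nonneg_right (mul_le_mul (hC _) (hC _) (norm_nonneg _) hC0)
        (norm_nonneg _))
  simp only [(hfin _).tsum_eq] at h1
  have h2 := ((tendsto_invFact hv0 hv).comp (tendsto_id.const_mul_atTop' two_pos)).mul
    ((tendsto_prod_qInf (w ^ ((a : ℤ) - e)) hq).mul (tendsto_prod_qInf (w ^ ((a : ℤ) + e)) hq))
  have h3 := tendsto_nhds_unique h1 h2
  rw [tsum_mul_left] at h3
  have h4 : ∑' j : ℤ, (-1) ^ j * w ^ (a * j ^ 2 + e * j) =
      qInf₃ (w ^ (2 * a)) (w ^ (a + e)) (w ^ (a - e)) (w ^ (2 * a)) := by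
    rw [hvv] at h3 hE
    rw [qInf₃]
    field_simp at h3
    linear_combination h3
  rw [← h4]
  exact hsum.of_norm.hasSum

end Limits

/-! ### Bilateral Bailey pairs and Bailey steps. -/

noncomputable section

/-- The kernel `1 / ((q)_{n-j} (q)_{m+n+j})` of bilateral Bailey pairs relative to `q ^ m`, where
`q = w ^ 2`. -/
def baileyKernel (w : ℂ) (m n j : ℤ) : ℂ := invFact w (n - j) * invFact w (m + n + j)

/-- The kernel which arises from `baileyKernel` by Bailey steps relative to `q ^ (m - 1)`. -/
def latticeKernel (w : ℂ) (m : ℤ) (S : ℂ) (n j : ℤ) : ℂ :=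
  baileyKernel w m n j * (S - w ^ (2 * (n - j)) * (S - 1))

/-- The geometric sum `∑_{a < d} q ^ (a (m + 2 j))`, where `q = w ^ 2`. -/
def geomSum (w : ℂ) (m j : ℤ) (d : ℕ) : ℂ := ∑ a ∈ Finset.range d, (w ^ (2 * (m + 2 * j))) ^ a

end

section Bailey

variable {w : ℂ}

theorem geomSum_succ (w : ℂ) (m j : ℤ) (d : ℕ) :
    geomSum w m j (d + 1) = w ^ (2 * (m + 2 * j)) * geomSum w m j d + 1 := by
  simp [geomSum, Finset.sum_range_succ', pow_succ', Finset.mul_sum]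

theorem geomSum_one (w : ℂ) (m j : ℤ) : geomSum w m j 1 = 1 := by simp [geomSum]

/-- With y = w^{m+2j}, multiplying by 1 + y fills in the odd powers between the even ones. -/
theorem geomSum_half (hw : ‖w‖ < 1) (m j : ℤ) (i : ℕ) :
    w ^ (m + 2 * j) * geomSum w m j i + 1 / (1 + w ^ (m + 2 * j)) =
      (∑ a ∈ Finset.range (2 * i + 1), (w ^ (m + 2 * j)) ^ a) / (1 + w ^ (m + 2 * j)) := by
  have h := one_add_zpow_ne_zero hw (m + 2 * j)
  rw [eq_div_iff h, add_mul, div_mul_cancel₀ _ h, geomSum]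
  have e : w ^ (2 * (m + 2 * j)) = (w ^ (m + 2 * j)) ^ 2 := by
    rw [mul_comm, zpow_mul]; norm_cast
  rw [e]
  induction i with
  | zero => simp
  | succ i ih =>
    rw [Finset.sum_range_succ, show 2 * (i + 1) + 1 = 2 * i + 1 + 1 + 1 by ring,
      Finset.sum_range_succ _ (2 * i + 1 + 1), Finset.sum_range_succ _ (2 * i + 1), ← ih]
    ring

theorem baileyKernel_eq_zero (hw0 : w ≠ 0) (hw : ‖w‖ < 1) {m n j : ℤ}
    (h : j ∉ Finset.Icc (-m - n) n) : baileyKernel w m n j = 0 := by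
  rw [Finset.mem_Icc, not_and_or] at h
  rcases h with h | h
  · rw [baileyKernel, invFact_of_neg hw0 hw (show m + n + j < 0 by omega), mul_zero]
  · rw [baileyKernel, invFact_of_neg hw0 hw (show n - j < 0 by omega), zero_mul]

theorem latticeKernel_one (w : ℂ) (m n j : ℤ) : latticeKernel w m 1 n j = baileyKernel w m n j := by
  simp [latticeKernel]

/-- The Bailey lemma with both parameters infinite. -/
theorem hasSum_bailey_sq (hw0 : w ≠ 0) (hw : ‖w‖ < 1) (m x j : ℤ) :
    HasSum (fun y => invFact w (x - y) * w ^ (2 * y ^ 2 + 2 * m * y) * baileyKernel w m y j)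
      (w ^ (2 * j ^ 2 + 2 * m * j) * baileyKernel w m x j) := by
  refine hasSum_of_eq (((Equiv.subRight j).hasSum_iff.mpr
    (hasSum_conv_sq hw0 hw (x - j) (m + 2 * j))).mul_left (w ^ (2 * j ^ 2 + 2 * m * j)))
    (fun y => ?_) ?_
  · simp only [Function.comp_apply, Equiv.subRight_apply, baileyKernel]
    rw [show x - j - (y - j) = x - y by ring, show y - j + (m + 2 * j) = m + y + j by ring,
      ← zpow_mul_zpow_eq hw0 (show (2 * j ^ 2 + 2 * m * j) + (2 * (y - j) ^ 2 +
        2 * (m + 2 * j) * (y - j)) = 2 * y ^ 2 + 2 * m * y by ring)]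
    ring
  · rw [baileyKernel, show x - j + (m + 2 * j) = m + x + j by ring]

/-- A Bailey step relative to `q ^ (m - 1)`. -/
theorem hasSum_bailey_lattice (hw0 : w ≠ 0) (hw : ‖w‖ < 1) (m x j : ℤ) (d : ℕ) :
    HasSum (fun y => invFact w (x - y) * w ^ (2 * y ^ 2 + 2 * (m - 1) * y) *
        latticeKernel w m (geomSum w m j d) y j)
      (w ^ (2 * j ^ 2 + 2 * (m - 1) * j) * latticeKernel w m (geomSum w m j (d + 1)) x j) := by
  -- With G the geometric sum, the part G of the kernel factor is summed relative to q^{m-1}. In the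
  -- part q^{y-j}(G-1) the power q^y restores a step relative to q^m. Together they give S' -
  -- q^{x-j}(S'-1) with S' = q^{m+2j}G + 1.
  have h₁ := ((Equiv.subRight j).hasSum_iff.mpr
    (hasSum_conv_sq_sub hw0 hw (x - j) (m + 2 * j))).mul_left
      (w ^ (2 * j ^ 2 + 2 * (m - 1) * j) * geomSum w m j d)
  have h₂ := (hasSum_bailey_sq hw0 hw m x j).mul_left (w ^ (-2 * j) * (geomSum w m j d - 1))
  refine hasSum_of_eq (h₁.sub h₂) (fun y => ?_) ?_
  · simp only [Function.comp_apply, Equiv.subRight_apply, baileyKernel, latticeKernel]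
    rw [show x - j - (y - j) = x - y by ring, show y - j + (m + 2 * j) = m + y + j by ring]
    have p1 := zpow_mul_zpow_eq hw0 (show (2 * j ^ 2 + 2 * (m - 1) * j) + (2 * (y - j) ^ 2 +
        2 * (m + 2 * j - 1) * (y - j)) = 2 * y ^ 2 + 2 * (m - 1) * y by ring)
    have p2 := zpow_mul_zpow_eq hw0 (show -2 * j + (2 * y ^ 2 + 2 * m * y) =
      2 * (y - j) + (2 * y ^ 2 + 2 * (m - 1) * y) by ring)
    rw [zpow_add₀ hw0 (2 * (y - j))] at p2
    linear_combination (invFact w (x - y) * invFact w (y - j) * invFact w (m + y + j)) *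
      ((geomSum w m j d - 1) * p2 - geomSum w m j d * p1)
  · rw [geomSum_succ, latticeKernel, baileyKernel, show x - j + (m + 2 * j) = m + x + j by ring]
    have p1 := zpow_mul_zpow_eq hw0 (show -2 * j + (2 * j ^ 2 + 2 * m * j) =
      2 * j ^ 2 + 2 * (m - 1) * j by ring)
    have p2 := zpow_mul_zpow_eq hw0 (show 2 * (x - j) + 2 * (m + 2 * j) = 2 * (m + x + j) by ring)
    linear_combination (invFact w (x - j) * invFact w (m + x + j)) *
      ((geomSum w m j d - 1) * p1 -
        w ^ (2 * j ^ 2 + 2 * (m - 1) * j) * geomSum w m j d * p2)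

/-- The Bailey lemma with the parameters `-q ^ ((m + 1) / 2)` and infinity. -/
theorem hasSum_bailey_half (hw0 : w ≠ 0) (hw : ‖w‖ < 1) (m x j : ℤ) :
    HasSum (fun y => invFact w (x - y) * (negInf w (m + 1 + 2 * x) / negInf w (m + 1 + 2 * y)) *
        w ^ (y ^ 2 + m * y) * baileyKernel w m y j)
      (w ^ (j ^ 2 + m * j) * baileyKernel w m x j) := by
  -- `hasSum_conv_half` needs x - j ≥ 0; otherwise every term vanishes.
  rcases lt_or_ge x j with h | h
  · refine hasSum_of_eq hasSum_zero (fun y => ?_) ?_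
    · rcases lt_or_ge x y with h' | h'
      · simp [invFact_of_neg hw0 hw (show x - y < 0 by omega)]
      · simp [baileyKernel, invFact_of_neg hw0 hw (show y - j < 0 by omega)]
    · simp [baileyKernel, invFact_of_neg hw0 hw (show x - j < 0 by omega)]
  refine hasSum_of_eq (((Equiv.subRight j).hasSum_iff.mpr
    (hasSum_conv_half hw0 hw (sub_nonneg.mpr h) (show (m + 1 + 2 * j) + (m + 1 + 2 * j) =
      2 * (m + 2 * j) + 2 by ring))).mul_left (w ^ (j ^ 2 + m * j) * negInf w (m + 1 + 2 * x)))
    (fun y => ?_) ?_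
  · simp only [Function.comp_apply, Equiv.subRight_apply, baileyKernel]
    rw [show x - j - (y - j) = x - y by ring, show y - j + (m + 2 * j) = m + y + j by ring,
      show m + 1 + 2 * j + 2 * (y - j) = m + 1 + 2 * y by ring,
      ← zpow_mul_zpow_eq hw0 (show (j ^ 2 + m * j) + ((y - j) ^ 2 - (y - j) +
        (m + 1 + 2 * j) * (y - j)) = y ^ 2 + m * y by ring)]
    ring
  · have n1 := negInf_ne_zero hw0 hw (m + 1 + 2 * j)
    have n2 := negInf_ne_zero hw0 hw (m + 1 + 2 * x)
    rw [baileyKernel, show x - j + (m + 2 * j) = m + x + j by ring,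
      show m + 1 + 2 * j + 2 * (x - j) = m + 1 + 2 * x by ring]
    field_simp

/-- The outermost sum has no upper entry. The parts S and q^{y-j}(S-1) of the kernel factor fall
under `hasSum_top` and `hasSum_top_succ`. -/
theorem hasSum_bailey_top (hw0 : w ≠ 0) (hw : ‖w‖ < 1) (m j : ℤ) (S : ℂ) :
    HasSum (fun y => negInf w m / negInf w (m + 2 * y) * w ^ (y ^ 2 + (m - 1) * y) *
        latticeKernel w m S y j)
      (negInf w m * (qInf (w ^ 2) (w ^ 2))⁻¹ * w ^ (j ^ 2 + (m - 1) * j) *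
        (w ^ (m + 2 * j) * S + 1 / (1 + w ^ (m + 2 * j)))) := by
  have h₁ := ((Equiv.subRight j).hasSum_iff.mpr (hasSum_top hw0 hw (m + 2 * j))).mul_left
    (negInf w m * w ^ (j ^ 2 + (m - 1) * j) * S)
  have h₂ := ((Equiv.subRight j).hasSum_iff.mpr (hasSum_top_succ hw0 hw (m + 2 * j))).mul_left
    (negInf w m * w ^ (j ^ 2 + (m - 1) * j) * (S - 1))
  refine hasSum_of_eq (h₁.sub h₂) (fun y => ?_) ?_
  · simp only [Function.comp_apply, Equiv.subRight_apply, baileyKernel, latticeKernel]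
    rw [show y - j + (m + 2 * j) = m + y + j by ring,
      show m + 2 * j + 2 * (y - j) = m + 2 * y by ring,
      ← zpow_mul_zpow_eq hw0 (show (j ^ 2 + (m - 1) * j) + ((y - j) ^ 2 +
        (m + 2 * j - 1) * (y - j)) = y ^ 2 + (m - 1) * y by ring),
      ← zpow_mul_zpow_eq hw0 (show 2 * (y - j) + ((y - j) ^ 2 +
        (m + 2 * j - 1) * (y - j)) = (y - j) ^ 2 + (m + 2 * j + 1) * (y - j) by ring)]
    ring
  · ring

theorem invFact_eq_prod_mul (hw0 : w ≠ 0) (hw : ‖w‖ < 1) (N : ℕ) (c : ℤ) :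
    invFact w (c - 1) =
      (∏ u ∈ Finset.range N, (1 - w ^ (2 * c) * (w ^ 2) ^ u)) * invFact w (c + N - 1) := by
  induction N with
  | zero => simp
  | succ N ih =>
    rw [ih, invFact_sub_one hw0 hw, Finset.prod_range_succ, zpow_mul_sq_pow hw0]
    push_cast
    rw [show c + ((N : ℤ) + 1) - 1 = c + N by ring, mul_add]
    ring

theorem qPoch_self (hw0 : w ≠ 0) (k : ℤ) : qPoch (w ^ 2) (w ^ 2) k = (invFact w k)⁻¹ := by
  rw [qPoch, invFact, inv_div]
  congr 2
  rw [zpow_add₀ hw0, zpow_mul, mul_comm]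
  norm_cast

theorem qBinom_eq (hw0 : w ≠ 0) (N j : ℤ) : qBinom (w ^ 2) N j =
    if 0 ≤ j ∧ j ≤ N then invFact w j * invFact w (N - j) / invFact w N else 0 := by
  simp only [qBinom, qPoch_self hw0]
  congr 1
  rw [← mul_inv, inv_div_inv]

/-- The bilateral Bailey pair relative to `q ^ m` with `α_j = (-1) ^ j q ^ (j (j - 1) / 2)`. -/
theorem hasSum_bailey_initial (hw0 : w ≠ 0) (hw : ‖w‖ < 1) {m : ℤ} (hm : 0 ≤ m) (n : ℤ) :
    HasSum (fun j => (-1) ^ j * w ^ (j ^ 2 - j) * baileyKernel w m n j)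
      ((-1) ^ n * w ^ (n ^ 2 - n) * qBinom (w ^ 2) (m + n) (m + 2 * n)) := by
  rw [qBinom_eq hw0]
  rcases lt_or_ge (m + 2 * n) 0 with h | h
  · rw [if_neg (by omega), mul_zero]
    refine hasSum_of_eq hasSum_zero (fun j => ?_) rfl
    rw [baileyKernel_eq_zero hw0 hw (by rw [Finset.mem_Icc]; omega), mul_zero]
  obtain ⟨N, hN⟩ : ∃ N : ℕ, m + 2 * n = N := ⟨_, (Int.toNat_of_nonneg h).symm⟩
  -- Order N = m + 2n, argument q^{1-n}, summation index t = n - j.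
  refine hasSum_of_eq (((Equiv.subLeft n).hasSum_iff.mpr (hasSum_conv_binomial hw0 hw N
    (zpow_ne_zero (2 * (1 - n)) hw0))).mul_left ((-1) ^ n * w ^ (n ^ 2 - n))) (fun j => ?_) ?_
  · simp only [Function.comp_apply, Equiv.subLeft_apply, baileyKernel]
    rw [neg_eq_neg_one_mul (w ^ _), mul_zpow, ← zpow_mul, ← hN,
      show m + 2 * n - (n - j) = m + n + j by ring]
    have p1 := zpow_mul_zpow_eq hw0 (show 2 * (1 - n) * (n - j) + ((n - j) ^ 2 - (n - j)) =
      -n ^ 2 + n + (j ^ 2 - j) by ring)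
    have p2 := zpow_mul_zpow_eq hw0 (show (n ^ 2 - n) + (-n ^ 2 + n + (j ^ 2 - j)) =
      j ^ 2 - j by ring)
    have p3 : (-1 : ℂ) ^ n * (-1) ^ (n - j) = (-1) ^ j := by
      rw [← zpow_add₀ (by norm_num), show n + (n - j) = 2 * (n - j) + j by ring,
        zpow_add₀ (by norm_num), zpow_mul]
      simp
    rw [← p3, ← p2, ← p1]
    ring
  · rw [mul_assoc, mul_assoc]
    congr 2
    have hp := invFact_eq_prod_mul hw0 hw N (1 - n)
    rw [show 1 - n + (N : ℤ) - 1 = m + n by omega, show 1 - n - 1 = -n by ring] at hp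
    -- For n > 0 the product contains the factor 1 - q^0, matching the vanishing binomial
    -- coefficient.
    rcases lt_or_ge 0 n with hn | hn
    · rw [if_neg (by omega)]
      rw [invFact_of_neg hw0 hw (by omega), eq_comm, mul_eq_zero, or_iff_left
        (invFact_ne_zero hw0 hw (by omega))] at hp
      rw [hp, mul_zero]
    · rw [if_pos ⟨h, by omega⟩, show m + n - (m + 2 * n) = -n by ring, hp, hN]
      have := invFact_ne_zero hw0 hw (show 0 ≤ m + n by omega)
      field_simp

/-- Only y ≤ x contributes, and there the window [-m-y, y] lies in [-m-x, x]; so the j-sum can be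
taken over one finite set and exchanged with the y-sum. -/
theorem hasSum_bailey_step {m x : ℤ} {T A c : ℤ → ℂ} {κ κ' : ℤ → ℤ → ℂ}
    (hT : ∀ y, x < y → T y = 0) (hκ : ∀ y j, j ∉ Finset.Icc (-m - y) y → κ y j = 0)
    (h : ∀ j, HasSum (fun y => T y * κ y j) (c j * κ' x j)) :
    HasSum (fun y => T y * ∑ j ∈ Finset.Icc (-m - y) y, A j * κ y j)
      (∑ j ∈ Finset.Icc (-m - x) x, A j * c j * κ' x j) := by
  refine hasSum_of_eq (hasSum_sum fun j (_ : j ∈ Finset.Icc (-m - x) x) => (h j).mul_left (A j))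
    (fun y => ?_) (Finset.sum_congr rfl fun j _ => by ring)
  rcases lt_or_ge x y with hy | hy
  · simp [hT y hy]
  · rw [Finset.mul_sum, Finset.sum_subset (Finset.Icc_subset_Icc (show -m - x ≤ -m - y by omega) hy)
      fun j _ hj => by rw [hκ y j hj]; ring]
    exact Finset.sum_congr rfl fun j _ => by ring

end Bailey

/-! ### Iterated summation along chains. -/

section Chains

/-- The last variable is summed out first, replacing v (n+1) by v n; joint summability allows the
iterated sum to be identified with the multiple one. -/
theorem hasSum_chain {n : ℕ} {a : ℤ → ℂ} {T : ℕ → ℤ → ℤ → ℂ} {v : ℕ → ℤ → ℂ} {S : ℂ}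
    (hstep : ∀ k < n, ∀ x, HasSum (fun y => T k x y * v (k + 1) y) (v k x))
    (hsum : Summable fun s : Fin (n + 1) → ℤ =>
      a (s 0) * (∏ k : Fin n, T k (s k.castSucc) (s k.succ)) * v n (s (Fin.last n)))
    (h0 : HasSum (fun x => a x * v 0 x) S) :
    HasSum (fun s : Fin (n + 1) → ℤ =>
      a (s 0) * (∏ k : Fin n, T k (s k.castSucc) (s k.succ)) * v n (s (Fin.last n))) S := by
  induction n with
  | zero =>
    rw [← (Equiv.funUnique (Fin 1) ℤ).symm.hasSum_iff]
    refine hasSum_of_eq h0 (fun x => ?_) rfl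
    simp [Equiv.funUnique]
  | succ n ih =>
    let e : (Fin (n + 1) → ℤ) × ℤ ≃ (Fin (n + 2) → ℤ) :=
      (Equiv.prodComm _ _).trans (Fin.snocEquiv fun _ => ℤ)
    have he : ∀ (s : Fin (n + 1) → ℤ) (y : ℤ), a (e (s, y) 0) *
        (∏ k : Fin (n + 1), T k (e (s, y) k.castSucc) (e (s, y) k.succ)) *
          v (n + 1) (e (s, y) (Fin.last (n + 1))) =
        a (s 0) * (∏ k : Fin n, T k (s k.castSucc) (s k.succ)) *
          (T n (s (Fin.last n)) y * v (n + 1) y) := by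
      intro s y
      have h1 : ∀ k : Fin (n + 1), e (s, y) k.castSucc = s k := fun k => by
        simp [e, Fin.snocEquiv]
      have h2 : e (s, y) (Fin.last (n + 1)) = y := by simp [e, Fin.snocEquiv]
      rw [Fin.prod_univ_castSucc, ← Fin.castSucc_zero, h1]
      simp only [Fin.succ_last, Fin.succ_castSucc, h1, h2, Fin.val_castSucc, Fin.val_last]
      ring
    have hsum' := (e.summable_iff.mpr hsum).hasSum
    have hfib := hsum'.prod_fiberwise (g := fun s => a (s 0) *
        (∏ k : Fin n, T k (s k.castSucc) (s k.succ)) * v n (s (Fin.last n))) fun s => by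
      refine hasSum_of_eq ((hstep n (Nat.lt_succ_self n) (s (Fin.last n))).mul_left
        (a (s 0) * ∏ k : Fin n, T k (s k.castSucc) (s k.succ))) (fun y => ?_) rfl
      exact he s y
    have := ih (fun k hk => hstep k (hk.trans (Nat.lt_succ_self n))) hfib.summable
    rw [this.unique hfib, ← e.hasSum_iff]
    exact hsum'

theorem summable_prod_coord {n : ℕ} {f : Fin n → ℤ → ℝ} (h0 : ∀ k x, 0 ≤ f k x)
    (hf : ∀ k, Summable (f k)) : Summable fun s : Fin n → ℤ => ∏ k, f k (s k) := by
  induction n with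
  | zero => exact Summable.of_finite
  | succ n ih =>
    rw [← (Fin.consEquiv fun _ : Fin (n + 1) => ℤ).summable_iff]
    refine ((hf 0).mul_of_nonneg (ih (fun k => h0 k.succ) fun k => hf k.succ) (h0 0)
      fun s => Finset.prod_nonneg fun k _ => h0 _ _).congr fun s => ?_
    simp [Fin.consEquiv, Fin.prod_univ_succ]

end Chains

/-! ### Evaluation of the multiple sum as a single series. -/

noncomputable section

/-- The weight of the largest entry `s_1` of a chain. -/
def topWeight (w : ℂ) (m : ℤ) (i : ℕ) (x : ℤ) : ℂ :=
  negInf w m / negInf w (m + 2 * x) * w ^ (x ^ 2 + m * x + x - if 1 ≤ i then 2 * x else 0)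

/-- The transfer factor between the entries `s_{k+1}` and `s_{k+2}` of a chain of length `p + 2`. -/
def transfer (w : ℂ) (m : ℤ) (p i k : ℕ) (x y : ℤ) : ℂ :=
  if k < p then invFact w (x - y) * w ^ (2 * y ^ 2 + 2 * m * y - if k + 2 ≤ i then 2 * y else 0)
  else invFact w (x - y) * (negInf w (m + 1 + 2 * x) / negInf w (m + 1 + 2 * y)) *
    w ^ (y ^ 2 + m * y) * ((-1) ^ y * w ^ (y ^ 2 - y) * qBinom (w ^ 2) (m + y) (m + 2 * y))

/-- The `α`-sequence after the summation over all entries below `s_{k+1}`. -/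
def alphaSeq (w : ℂ) (m : ℤ) (p i k : ℕ) (j : ℤ) : ℂ :=
  (-1) ^ j * w ^ (2 * j ^ 2 + (m - 1) * j + 2 * (p - k) * (j ^ 2 + m * j) -
    2 * (i - (k + 1) : ℕ) * j)

/-- The sum over all entries below `s_{k+1} = x` of a chain. -/
def lowerSum (w : ℂ) (m : ℤ) (p i k : ℕ) (x : ℤ) : ℂ :=
  if k ≤ p then ∑ j ∈ Finset.Icc (-m - x) x,
    alphaSeq w m p i k j * latticeKernel w m (geomSum w m j (i - (k + 1) + 1)) x j
  else 1

/-- The total contribution of the index `j` of the `α`-sequence. -/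
def alphaTotal (w : ℂ) (m : ℤ) (p i : ℕ) (j : ℤ) : ℂ :=
  negInf w m * (qInf (w ^ 2) (w ^ 2))⁻¹ *
    ((-1) ^ j * w ^ ((2 * p + 3) * j ^ 2 + 2 * (m * (p + 1) - i) * j) *
      ((∑ a ∈ Finset.range (2 * i + 1), (w ^ (m + 2 * j)) ^ a) / (1 + w ^ (m + 2 * j))))

end

section Transfer

variable {w : ℂ}

theorem hasSum_transfer (hw0 : w ≠ 0) (hw : ‖w‖ < 1) {m : ℤ} (hm : 0 ≤ m) {p i k : ℕ}
    (hi : i ≤ p + 1) (hk : k < p + 1) (x : ℤ) :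
    HasSum (fun y => transfer w m p i k x y * lowerSum w m p i (k + 1) y)
      (lowerSum w m p i k x) := by
  rw [lowerSum, if_pos (by omega)]
  have hE : ∀ y, x < y → invFact w (x - y) = 0 := fun y hy =>
    invFact_of_neg hw0 hw (by omega)
  have hK : ∀ y j, j ∉ Finset.Icc (-m - y) y → baileyKernel w m y j = 0 := fun y j hj =>
    baileyKernel_eq_zero hw0 hw hj
  rcases Nat.lt_or_ge k p with hkp | hkp
  · simp only [transfer, if_pos hkp, lowerSum, if_pos (show k + 1 ≤ p by omega)]
    -- The entry y = s_{k+2} carries q^{-y} exactly when k + 2 ≤ i. Otherwise the truncated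
    -- subtraction i - (k+1) is 0, the geometric sum is 1 and the kernel is the plain one.
    by_cases hki : k + 2 ≤ i
    · simp only [if_pos hki]
      obtain ⟨d, rfl⟩ : ∃ d, i = k + 2 + d := ⟨i - (k + 2), by omega⟩
      rw [show k + 2 + d - (k + 1 + 1) = d by omega, show k + 2 + d - (k + 1) = d + 1 by omega]
      refine hasSum_of_eq (hasSum_bailey_step (m := m) (x := x)
        (A := alphaSeq w m p (k + 2 + d) (k + 1)) (c := fun j => w ^ (2 * j ^ 2 + 2 * (m - 1) * j))
        (T := fun y => invFact w (x - y) * w ^ (2 * y ^ 2 + 2 * (m - 1) * y))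
        (κ := fun y j => latticeKernel w m (geomSum w m j (d + 1)) y j)
        (κ' := fun y j => latticeKernel w m (geomSum w m j (d + 1 + 1)) y j)
        (fun y hy => by simp [hE y hy]) (fun y j hj => by simp [latticeKernel, hK y j hj])
        (fun j => hasSum_bailey_lattice hw0 hw m x j (d + 1))) (fun y => ?_)
        (Finset.sum_congr rfl fun j _ => ?_)
      · rw [show 2 * y ^ 2 + 2 * m * y - 2 * y = 2 * y ^ 2 + 2 * (m - 1) * y by ring]
      · congr 1
        rw [alphaSeq, alphaSeq, mul_assoc ((-1 : ℂ) ^ j), zpow_mul_zpow_eq hw0 rfl,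
          show k + 2 + d - (k + 1 + 1) = d by omega, show k + 2 + d - (k + 1) = d + 1 by omega]
        congr 2
        push_cast
        ring
    · simp only [if_neg hki, sub_zero]
      rw [show i - (k + 1 + 1) = 0 by omega, show i - (k + 1) = 0 by omega]
      simp only [zero_add, geomSum_one, latticeKernel_one]
      refine hasSum_of_eq (hasSum_bailey_step (m := m) (x := x)
        (A := alphaSeq w m p i (k + 1)) (c := fun j => w ^ (2 * j ^ 2 + 2 * m * j))
        (fun y hy => by simp [hE y hy]) hK
        (fun j => hasSum_bailey_sq hw0 hw m x j)) (fun y => rfl)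
        (Finset.sum_congr rfl fun j _ => ?_)
      congr 1
      rw [alphaSeq, alphaSeq, mul_assoc ((-1 : ℂ) ^ j), zpow_mul_zpow_eq hw0 rfl,
        show i - (k + 1 + 1) = 0 by omega, show i - (k + 1) = 0 by omega]
      congr 2
      push_cast
      ring
  · obtain rfl : k = p := by omega
    simp only [transfer, if_neg (lt_irrefl k), lowerSum, if_neg (show ¬ k + 1 ≤ k by omega)]
    rw [show i - (k + 1) = 0 by omega]
    simp only [zero_add, geomSum_one, latticeKernel_one, mul_one]
    refine hasSum_of_eq (hasSum_bailey_step (m := m) (x := x)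
      (A := fun j => (-1) ^ j * w ^ (j ^ 2 - j)) (c := fun j => w ^ (j ^ 2 + m * j))
      (T := fun y => invFact w (x - y) *
        (negInf w (m + 1 + 2 * x) / negInf w (m + 1 + 2 * y)) * w ^ (y ^ 2 + m * y))
      (fun y hy => by simp [hE y hy]) hK
      (fun j => hasSum_bailey_half hw0 hw m x j)) (fun y => ?_)
      (Finset.sum_congr rfl fun j _ => ?_)
    · congr 1
      refine (hasSum_bailey_initial hw0 hw hm y).unique (hasSum_sum_of_ne_finset_zero fun j hj => ?_)
      rw [hK y j hj, mul_zero]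
    · congr 1
      rw [alphaSeq, mul_assoc ((-1 : ℂ) ^ j), zpow_mul_zpow_eq hw0 rfl,
        show i - (k + 1) = 0 by omega]
      congr 2
      push_cast
      ring

theorem hasSum_topWeight (hw0 : w ≠ 0) (hw : ‖w‖ < 1) (m : ℤ) (p i : ℕ) (j : ℤ) :
    HasSum (fun x => topWeight w m i x *
        (alphaSeq w m p i 0 j * latticeKernel w m (geomSum w m j (i - (0 + 1) + 1)) x j))
      (alphaTotal w m p i j) := by
  refine hasSum_of_eq ((hasSum_bailey_top hw0 hw m j (geomSum w m j i)).mul_left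
    (alphaSeq w m p i 0 j * if 1 ≤ i then 1 else w ^ (2 * j))) (fun x => ?_) ?_
  · rw [topWeight]
    by_cases hi : 1 ≤ i
    · simp only [if_pos hi]
      rw [show i - (0 + 1) + 1 = i by omega,
        show x ^ 2 + m * x + x - 2 * x = x ^ 2 + (m - 1) * x by ring]
      ring
    -- For i = 0 the empty geometric sum S = 0 makes the kernel factor q^{x-j}; with the prefactor
    -- q^j it supplies the q^x that distinguishes this case.
    · obtain rfl : i = 0 := by omega
      simp only [if_neg hi, sub_zero]
      rw [show 0 - (0 + 1) + 1 = 1 by omega, geomSum_one, latticeKernel_one, latticeKernel,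
        geomSum, Finset.sum_range_zero]
      have p1 := zpow_mul_zpow_eq hw0 (show 2 * j + (2 * (x - j) + (x ^ 2 + (m - 1) * x)) =
        x ^ 2 + m * x + x by ring)
      rw [← p1, zpow_add₀ hw0 (2 * (x - j))]
      ring
  · rw [geomSum_half hw, alphaTotal, alphaSeq]
    by_cases hi : 1 ≤ i
    · simp only [if_pos hi]
      rw [← zpow_mul_zpow_eq hw0 (show (2 * j ^ 2 + (m - 1) * j + 2 * (p - (0 : ℕ)) * (j ^ 2 + m * j) -
        2 * (i - (0 + 1) : ℕ) * j) + (j ^ 2 + (m - 1) * j) =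
          (2 * p + 3) * j ^ 2 + 2 * (m * (p + 1) - i) * j by push_cast [hi]; ring)]
      ring
    · obtain rfl : i = 0 := by omega
      simp only [if_neg hi]
      rw [← zpow_mul_zpow_eq hw0 (show (2 * j ^ 2 + (m - 1) * j + 2 * (p - (0 : ℕ)) * (j ^ 2 + m * j) -
        2 * (0 - (0 + 1) : ℕ) * j) + (2 * j + (j ^ 2 + (m - 1) * j)) =
          (2 * p + 3) * j ^ 2 + 2 * (m * (p + 1) - (0 : ℕ)) * j by
            simp; ring),
        zpow_add₀ hw0 (2 * j)]
      ring

theorem summable_alphaSeq (hw0 : w ≠ 0) (hw : ‖w‖ < 1) (m : ℤ) (p i : ℕ) :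
    Summable fun j => ‖alphaSeq w m p i 0 j‖ *
      (2 * ‖geomSum w m j (i - (0 + 1) + 1)‖ + 1) := by
  have hα : ∀ j, ‖alphaSeq w m p i 0 j‖ = ‖w ^ ((2 + 2 * p) * j ^ 2 +
      (m - 1 + 2 * p * m - 2 * (i - (0 + 1) : ℕ)) * j)‖ := fun j => by
    rw [alphaSeq, norm_mul, norm_zpow (-1 : ℂ), norm_neg, norm_one, one_zpow, one_mul]
    congr 2
    push_cast
    ring
  have h1 : ∀ a : ℕ, Summable fun j => ‖alphaSeq w m p i 0 j‖ *
      ‖(w ^ (2 * (m + 2 * j))) ^ a‖ := fun a => by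
    refine ((summable_norm_zpow_quadratic hw0 hw (a := 2 + 2 * p) (by positivity)
      (m - 1 + 2 * p * m - 2 * (i - (0 + 1) : ℕ) + 4 * a)).mul_left ‖w ^ (2 * m * a)‖).congr
        fun j => ?_
    rw [hα, ← zpow_natCast, ← zpow_mul, ← norm_mul, ← norm_mul, zpow_mul_zpow_eq hw0 rfl,
      zpow_mul_zpow_eq hw0 rfl]
    congr 2
    ring
  have h2 := ((summable_sum fun a (_ : a ∈ Finset.range (i - (0 + 1) + 1)) => h1 a).mul_left 2).add
    (summable_norm_zpow_quadratic hw0 hw (a := 2 + 2 * p) (by positivity)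
      (m - 1 + 2 * p * m - 2 * (i - (0 + 1) : ℕ)))
  refine Summable.of_nonneg_of_le (fun _ => by positivity) (fun j => ?_) h2
  rw [← hα, mul_add, mul_one, ← Finset.mul_sum]
  have h3 := norm_sum_le (Finset.range (i - (0 + 1) + 1)) fun a => (w ^ (2 * (m + 2 * j))) ^ a
  have h4 := mul_le_mul_of_nonneg_left h3 (norm_nonneg (alphaSeq w m p i 0 j))
  rw [geomSum]
  linarith

theorem exists_norm_topWeight_le (hw0 : w ≠ 0) (hw : ‖w‖ < 1) (m : ℤ) (i : ℕ) :
    ∃ g : ℤ → ℝ, (∀ x, 0 ≤ g x) ∧ Summable g ∧ ∀ x, -m ≤ x → ‖topWeight w m i x‖ ≤ g x := by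
  obtain ⟨D, hD0, hD⟩ := exists_norm_negInf_le hw0 hw m (-m)
  refine ⟨fun x => ‖negInf w m‖ * D * ‖w ^ (1 * x ^ 2 + (m + 1 - if 1 ≤ i then 2 else 0) * x)‖,
    fun x => by positivity, (summable_norm_zpow_quadratic hw0 hw one_pos _).mul_left _,
    fun x hx => ?_⟩
  rw [topWeight, div_eq_mul_inv, norm_mul, norm_mul]
  have e : x ^ 2 + m * x + x - (if 1 ≤ i then 2 * x else 0) =
    1 * x ^ 2 + (m + 1 - if 1 ≤ i then 2 else 0) * x := by split_ifs <;> ring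
  rw [e]
  exact mul_le_mul_of_nonneg_right (mul_le_mul_of_nonneg_left (hD x hx).2
    (norm_nonneg _)) (norm_nonneg _)

theorem exists_norm_transfer_le (hw0 : w ≠ 0) (hw : ‖w‖ < 1) (m : ℤ) (p i k : ℕ) :
    ∃ g : ℤ → ℝ, (∀ y, 0 ≤ g y) ∧ Summable g ∧
      ∀ x y, -m ≤ x → -m ≤ y → ‖transfer w m p i k x y‖ ≤ g y := by
  obtain ⟨C, hC0, hC⟩ := exists_norm_invFact_le hw0 hw
  by_cases hk : k < p
  · refine ⟨fun y => C * ‖w ^ (2 * y ^ 2 + (2 * m - if k + 2 ≤ i then 2 else 0) * y)‖,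
      fun y => by positivity, (summable_norm_zpow_quadratic hw0 hw two_pos _).mul_left _,
      fun x y _ _ => ?_⟩
    have e : 2 * y ^ 2 + 2 * m * y - (if k + 2 ≤ i then 2 * y else 0) =
      2 * y ^ 2 + (2 * m - if k + 2 ≤ i then 2 else 0) * y := by split_ifs <;> ring
    rw [transfer, if_pos hk, norm_mul, e]
    exact mul_le_mul_of_nonneg_right (hC _) (norm_nonneg _)
  · obtain ⟨D, hD0, hD⟩ := exists_norm_negInf_le hw0 hw (m + 1) (-m)
    refine ⟨fun y => C * (D * D) * ‖w ^ (y ^ 2 + m * y) * ((-1) ^ y * w ^ (y ^ 2 - y) *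
      qBinom (w ^ 2) (m + y) (m + 2 * y))‖, fun y => by positivity, Summable.mul_left _
      -- The binomial coefficient is zero unless m + 2y ≥ 0 and y ≤ 0, so the majorant has finite
      -- support.
      (summable_of_ne_finset_zero (s := Finset.Icc (-m) 0) fun y hy => ?_), fun x y hx hy => ?_⟩
    · rw [Finset.mem_Icc] at hy
      rw [qBinom, if_neg (by omega), mul_zero, mul_zero, norm_zero]
    · rw [transfer, if_neg hk, div_eq_mul_inv, mul_assoc _ (w ^ _), norm_mul, norm_mul, norm_mul]
      exact mul_le_mul_of_nonneg_right (mul_le_mul (hC _) (mul_le_mul (hD x hx).1 (hD y hy).2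
        (norm_nonneg _) hD0) (by positivity) hC0) (norm_nonneg _)

/-- Fubini for an absolutely convergent double series in (x, j). A nonzero kernel forces -m - x ≤ j
≤ x, hence x ≥ -m and |q^{x-j}| ≤ 1, which is what the majorant needs. -/
theorem exists_hasSum_alphaTotal (hw0 : w ≠ 0) (hw : ‖w‖ < 1) {m : ℤ} (hm : 0 ≤ m) (p i : ℕ) :
    ∃ S, HasSum (alphaTotal w m p i) S ∧
      HasSum (fun x => topWeight w m i x * lowerSum w m p i 0 x) S := by
  obtain ⟨C, hC0, hC⟩ := exists_norm_invFact_le hw0 hw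
  obtain ⟨g, hg0, hg, hgT⟩ := exists_norm_topWeight_le hw0 hw m i
  set G : ℤ → ℂ := fun j => geomSum w m j (i - (0 + 1) + 1) with hG
  have hsum : Summable fun z : ℤ × ℤ => topWeight w m i z.1 *
      (alphaSeq w m p i 0 z.2 * latticeKernel w m (G z.2) z.1 z.2) := by
    have h1 := hg.mul_of_nonneg (summable_alphaSeq hw0 hw m p i) hg0 (fun _ => by positivity)
    refine Summable.of_norm_bounded (h1.mul_left (C * C)) fun z => ?_
    obtain ⟨x, j⟩ := z
    dsimp only
    by_cases hj : j ∈ Finset.Icc (-m - x) x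
    · rw [Finset.mem_Icc] at hj
      have e2 : ‖latticeKernel w m (G j) x j‖ ≤ C * C * (2 * ‖G j‖ + 1) := by
        rw [latticeKernel, baileyKernel, norm_mul, norm_mul]
        refine mul_le_mul (mul_le_mul (hC _) (hC _) (norm_nonneg _) hC0) ?_ (norm_nonneg _)
          (by positivity)
        have e3 : ‖w ^ (2 * (x - j))‖ ≤ 1 := by
          rw [norm_zpow]
          exact zpow_le_one₀ (norm_pos_iff.mpr hw0) hw.le (by omega)
        calc _ ≤ ‖G j‖ + ‖w ^ (2 * (x - j)) * (G j - 1)‖ := norm_sub_le _ _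
          _ ≤ ‖G j‖ + 1 * (‖G j‖ + 1) := by
            rw [norm_mul]
            gcongr
            exact (norm_sub_le _ _).trans (by simp)
          _ = _ := by ring
      rw [norm_mul, norm_mul]
      calc _ ≤ _ * (‖alphaSeq w m p i 0 j‖ * _) := mul_le_mul (hgT x (by omega))
            (mul_le_mul_of_nonneg_left e2 (norm_nonneg _)) (by positivity) (hg0 x)
        _ = _ := by simp only [hG]; ring
    · rw [latticeKernel, baileyKernel_eq_zero hw0 hw hj]
      simp only [zero_mul, mul_zero, norm_zero]
      have := hg0 x
      positivity
  have h1 := ((Equiv.prodComm ℤ ℤ).hasSum_iff.mpr hsum.hasSum).prod_fiberwise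
    (g := alphaTotal w m p i) (fun j => hasSum_topWeight hw0 hw m p i j)
  have hfib : ∀ x, HasSum (fun j => topWeight w m i x *
      (alphaSeq w m p i 0 j * latticeKernel w m (G j) x j))
      (topWeight w m i x * lowerSum w m p i 0 x) := fun x => by
    rw [lowerSum, if_pos (Nat.zero_le p)]
    refine HasSum.mul_left _ (hasSum_sum_of_ne_finset_zero fun j hj => ?_)
    rw [latticeKernel, baileyKernel_eq_zero hw0 hw hj, zero_mul, mul_zero]
  exact ⟨_, h1, HasSum.prod_fiberwise hsum.hasSum hfib⟩

end Transfer

/-! ### Theta series, reflection and the triple product. -/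

noncomputable section

/-- The summands of the theta series to which the multiple sums reduce. -/
def thetaTerm (w : ℂ) (m : ℤ) (p i c : ℕ) (j : ℤ) : ℂ :=
  (-1) ^ j * w ^ ((2 * p + 3) * j ^ 2 + 2 * (m * (p + 1) - i) * j) * (w ^ (m + 2 * j)) ^ c

end

section Theta

variable {w : ℂ}

theorem hasSum_thetaTerm (hw0 : w ≠ 0) (hw : ‖w‖ < 1) (m : ℤ) (p i c : ℕ) :
    HasSum (thetaTerm w m p i c)
      (w ^ (m * c) * qInf₃ (w ^ (2 * (2 * p + 3)))
        (w ^ ((2 * p + 3 : ℕ) + (2 * (m * (p + 1) - i) + 2 * c) : ℤ))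
        (w ^ ((2 * p + 3 : ℕ) - (2 * (m * (p + 1) - i) + 2 * c) : ℤ))
        (w ^ (2 * (2 * p + 3)))) := by
  refine hasSum_of_eq ((hasSum_jacobi_triple hw0 hw (show 0 < 2 * p + 3 by omega)
    (2 * (m * (p + 1) - i) + 2 * c)).mul_left (w ^ (m * c))) (fun j => ?_) rfl
  rw [thetaTerm, ← zpow_natCast (w ^ (m + 2 * j)), ← zpow_mul, mul_left_comm, mul_assoc,
    zpow_mul_zpow_eq hw0 rfl, zpow_mul_zpow_eq hw0 rfl]
  congr 2
  push_cast
  ring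

/-- The shift of the summation index by M turns the triple product into the form used in d_{2M+1},
and produces its sign and prefactor. -/
theorem hasSum_thetaTerm_odd (hw0 : w ≠ 0) (hw : ‖w‖ < 1) (M p i l : ℕ) :
    HasSum (thetaTerm w (2 * M + 1 : ℕ) p i (2 * l))
      ((-1) ^ M * w ^ (-(2 * p + 1) * M ^ 2 + 2 * (i - p - 1) * M : ℤ) * (w ^ 2) ^ l *
        qInf₃ (w ^ (2 * (2 * p + 3)))
        (w ^ ((2 * p + 3 : ℕ) + (2 * p + 2 - 2 * M - 2 * i + 4 * l) : ℤ))
        (w ^ ((2 * p + 3 : ℕ) - (2 * p + 2 - 2 * M - 2 * i + 4 * l) : ℤ))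
        (w ^ (2 * (2 * p + 3)))) := by
  refine hasSum_of_eq (((Equiv.addRight (M : ℤ)).hasSum_iff.mpr
    (hasSum_jacobi_triple hw0 hw (show 0 < 2 * p + 3 by omega)
      (2 * p + 2 - 2 * M - 2 * i + 4 * l))).mul_left
    ((-1) ^ M * w ^ (-(2 * p + 1) * M ^ 2 + 2 * (i - p - 1) * M : ℤ) * (w ^ 2) ^ l))
      (fun j => ?_) rfl
  have h1 : ((-1 : ℂ) ^ M) * (-1) ^ M = 1 := by rw [← mul_pow]; simp
  simp only [Function.comp_apply, Equiv.coe_addRight]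
  rw [thetaTerm, ← zpow_natCast (w ^ (((2 * M + 1 : ℕ) : ℤ) + 2 * j)), ← zpow_mul,
    zpow_add₀ (show (-1 : ℂ) ≠ 0 by norm_num), zpow_natCast]
  have h2 := zpow_mul_zpow_eq hw0 (show (-(2 * p + 1) * M ^ 2 + 2 * (i - p - 1) * M + 2 * l : ℤ) +
    ((2 * p + 3 : ℕ) * (j + M) ^ 2 + (2 * p + 2 - 2 * M - 2 * i + 4 * l) * (j + M)) =
    ((2 * p + 3) * j ^ 2 + 2 * ((2 * M + 1 : ℕ) * (p + 1) - i) * j) +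
      ((2 * M + 1 : ℕ) + 2 * j) * (2 * l : ℕ) by push_cast; ring)
  rw [zpow_add₀ hw0 ((2 * p + 3) * j ^ 2 + _), ← zpow_mul_sq_pow hw0] at h2
  generalize (-1 : ℂ) ^ M = s at *
  linear_combination -(-1) ^ j * h2 - (-1) ^ j *
    (w ^ (-(2 * p + 1) * M ^ 2 + 2 * (i - p - 1) * M : ℤ) * (w ^ 2) ^ l *
    w ^ ((2 * p + 3 : ℕ) * (j + M) ^ 2 + (2 * p + 2 - 2 * M - 2 * i + 4 * l) * (j + M) : ℤ)) * h1

theorem neg_one_zpow_reflect (m : ℕ) (j : ℤ) : (-1 : ℂ) ^ (-m - j : ℤ) = (-1) ^ m * (-1) ^ j := by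
  rw [show (-m - j : ℤ) = -(m + j) by ring, zpow_neg, ← inv_zpow, show (-1 : ℂ)⁻¹ = -1 by norm_num,
    zpow_add₀ (by norm_num), zpow_natCast]

theorem zpow_quadratic_reflect (hw0 : w ≠ 0) (m p i : ℕ) (j : ℤ) :
    w ^ ((2 * p + 3) * (-m - j) ^ 2 + 2 * (m * (p + 1) - i) * (-m - j) : ℤ) =
      w ^ ((2 * p + 3) * j ^ 2 + 2 * (m * (p + 1) - i) * j : ℤ) *
        (w ^ (m + 2 * j : ℤ)) ^ (m + 2 * i) := by
  rw [← zpow_natCast (w ^ (m + 2 * j : ℤ)), ← zpow_mul, zpow_mul_zpow_eq hw0 rfl]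
  congr 1
  push_cast
  ring

theorem zpow_linear_reflect (w : ℂ) (m : ℕ) (j : ℤ) :
    w ^ (m + 2 * (-m - j) : ℤ) = (w ^ (m + 2 * j : ℤ))⁻¹ := by
  rw [← zpow_neg]; congr 1; ring

theorem thetaTerm_reflect (hw0 : w ≠ 0) (m p i : ℕ) {c d : ℕ} (h : c + d = m + 2 * i) (j : ℤ) :
    thetaTerm w m p i c (-m - j) = (-1) ^ m * thetaTerm w m p i d j := by
  rw [thetaTerm, thetaTerm, neg_one_zpow_reflect, zpow_quadratic_reflect hw0, zpow_linear_reflect,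
    ← h, pow_add, inv_pow]
  have := zpow_ne_zero (m + 2 * j : ℤ) hw0
  generalize w ^ (m + 2 * j : ℤ) = y at *
  field_simp

/-- Under y ↦ 1/y the palindromic sum 1 + ⋯ + y^{2i} changes by y^{-2i} and 1/(1+y) by y; the
Gaussian contributes y^{m+2i}, so (-1)^m y^{m+1} remains. -/
theorem alphaTotal_add_reflect (hw0 : w ≠ 0) (hw : ‖w‖ < 1) (m p i : ℕ) (j : ℤ) :
    alphaTotal w m p i j + alphaTotal w m p i (-m - j) =
      negInf w m * (qInf (w ^ 2) (w ^ 2))⁻¹ *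
        ((-1) ^ j * w ^ ((2 * p + 3) * j ^ 2 + 2 * (m * (p + 1) - i) * j : ℤ) *
          ((∑ a ∈ Finset.range (2 * i + 1), (w ^ (m + 2 * j : ℤ)) ^ a) *
            (1 + (-1) ^ m * (w ^ (m + 2 * j : ℤ)) ^ (m + 1)) / (1 + w ^ (m + 2 * j : ℤ)))) := by
  rw [alphaTotal, alphaTotal, neg_one_zpow_reflect, zpow_quadratic_reflect hw0,
    zpow_linear_reflect]
  have h1 := one_add_zpow_ne_zero hw (m + 2 * j)
  have h2 := zpow_ne_zero (m + 2 * j : ℤ) hw0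
  generalize w ^ (m + 2 * j : ℤ) = y at *
  have h3 : y ^ (2 * i) * ∑ a ∈ Finset.range (2 * i + 1), y⁻¹ ^ a =
      ∑ a ∈ Finset.range (2 * i + 1), y ^ a := by
    rw [Finset.mul_sum, ← Finset.sum_range_reflect]
    refine Finset.sum_congr rfl fun a ha => ?_
    have ha' : a ≤ 2 * i := Nat.lt_succ_iff.mp (Finset.mem_range.mp ha)
    rw [show 2 * i + 1 - 1 - a = 2 * i - a by omega, inv_pow, ← pow_sub₀ _ h2 (by omega)]
    congr 1
    omega
  have h4 : 1 + y⁻¹ = (1 + y) / y := by field_simp; ring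
  rw [← h3, pow_add, h4]
  have h5 : 1 + y ≠ 0 := h1
  field_simp
  ring

/-- For even m, 1 + y^{m+1} is divisible by 1 + y and the quotient is an alternating geometric sum.
The factor 1/2 is that of the average. -/
theorem hasSum_alphaTotal_even (hw0 : w ≠ 0) (hw : ‖w‖ < 1) (M p i : ℕ) {S : ℂ}
    (hS : HasSum (alphaTotal w (2 * M : ℕ) p i) S) : S = dEven (w ^ 2) w (p + 2) i M := by
  have h1 := hS.add ((Equiv.subLeft (-(2 * M : ℕ) : ℤ)).hasSum_iff.mpr hS)
  have h2 : HasSum (fun j => negInf w (2 * M : ℕ) * (qInf (w ^ 2) (w ^ 2))⁻¹ *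
      ∑ k ∈ Finset.range (2 * i + 1), ∑ l ∈ Finset.range (2 * M + 1),
        (-1) ^ l * thetaTerm w (2 * M : ℕ) p i (k + l) j) _ :=
    (hasSum_sum fun k _ => hasSum_sum fun l _ =>
      (hasSum_thetaTerm hw0 hw (2 * M : ℕ) p i (k + l)).mul_left ((-1) ^ l)).mul_left _
  have h3 := h1.unique (hasSum_of_eq h2 (fun j => ?_) rfl)
  · have h4 : S = (S + S) / 2 := by ring
    rw [h4, h3, dEven, negInf]
    have e1 : -w ^ (((2 * M : ℕ) : ℤ)) = -(w ^ 2) ^ M := by rw [zpow_natCast, pow_mul]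
    have e2 : (w ^ 2) ^ (2 * (p + 2) - 1) = w ^ (2 * (2 * p + 3)) := by
      rw [← pow_mul, show 2 * (p + 2) - 1 = 2 * p + 3 by omega]
    have e3 : ∀ {a b s t : ℂ}, s = t → a * b⁻¹ * s / 2 = a / (2 * b) * t := by
      rintro a b s _ rfl
      ring
    rw [e1, e2]
    refine e3 ?_
    refine Finset.sum_congr rfl fun k _ => Finset.sum_congr rfl fun l _ => ?_
    rw [← mul_assoc]
    congr 2
    · rw [← pow_mul, ← zpow_natCast]
      congr 1
      push_cast
      ring
    · congr 1; push_cast; ring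
    · congr 1; push_cast; ring
  · simp only [Function.comp_apply, Equiv.subLeft_apply]
    rw [alphaTotal_add_reflect hw0 hw]
    have h1 := one_add_zpow_ne_zero hw ((2 * M : ℕ) + 2 * j)
    simp only [thetaTerm]
    generalize w ^ (((2 * M : ℕ) : ℤ) + 2 * j) = y at *
    have h5 : (1 + (-1) ^ (2 * M) * y ^ (2 * M + 1)) / (1 + y) =
        ∑ l ∈ Finset.range (2 * M + 1), (-y) ^ l := by
      have e := mul_neg_geom_sum (-y) (2 * M + 1)
      rw [Odd.neg_pow ⟨M, rfl⟩ y] at e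
      rw [div_eq_iff h1, Even.neg_one_pow (even_two_mul M)]
      linear_combination -e
    rw [mul_div_assoc, h5, Finset.sum_mul_sum, Finset.mul_sum]
    congr 1
    refine Finset.sum_congr rfl fun k _ => ?_
    rw [Finset.mul_sum]
    refine Finset.sum_congr rfl fun l _ => ?_
    rw [neg_pow, pow_add]
    ring

/-- For odd m, 1 + ⋯ + y^{2i} = (1 - y^{2i+1})/(1 - y) and 1 - y^{m+1} is divisible by 1 - y². The
two resulting families of theta series are exchanged by reflection, so the 1/2 of the average
disappears. -/
theorem hasSum_alphaTotal_odd (hw0 : w ≠ 0) (hw : ‖w‖ < 1) (M p i : ℕ) {S : ℂ}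
    (hS : HasSum (alphaTotal w (2 * M + 1 : ℕ) p i) S) : S = dOdd (w ^ 2) w (p + 2) i M := by
  have h1 := hS.add ((Equiv.subLeft (-(2 * M + 1 : ℕ) : ℤ)).hasSum_iff.mpr hS)
  have hA := fun l => hasSum_thetaTerm_odd hw0 hw M p i l
  set J : ℕ → ℂ := fun l => (-1) ^ M * w ^ (-(2 * p + 1) * M ^ 2 + 2 * (i - p - 1) * M : ℤ) *
    (w ^ 2) ^ l * qInf₃ (w ^ (2 * (2 * p + 3)))
        (w ^ ((2 * p + 3 : ℕ) + (2 * p + 2 - 2 * M - 2 * i + 4 * l) : ℤ))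
        (w ^ ((2 * p + 3 : ℕ) - (2 * p + 2 - 2 * M - 2 * i + 4 * l) : ℤ))
        (w ^ (2 * (2 * p + 3))) with hJ
  -- Reflection takes the exponent 2i+1+2l to 2(M-l), with sign (-1)^m = -1.
  have hB : ∀ l ∈ Finset.range (M + 1),
      HasSum (thetaTerm w (2 * M + 1 : ℕ) p i (2 * i + 1 + 2 * l)) (-J (M - l)) := fun l hl => by
    have hl' : l ≤ M := Nat.lt_succ_iff.mp (Finset.mem_range.mp hl)
    refine hasSum_of_eq ((Equiv.subLeft (-(2 * M + 1 : ℕ) : ℤ)).hasSum_iff.mpr (hA (M - l))).neg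
      (fun j => ?_) rfl
    simp only [Function.comp_apply, Equiv.subLeft_apply]
    rw [thetaTerm_reflect hw0 (2 * M + 1) p i
      (show 2 * (M - l) + (2 * i + 1 + 2 * l) = 2 * M + 1 + 2 * i by omega),
      Odd.neg_one_pow ⟨M, rfl⟩]
    ring
  have h2 : HasSum (fun j => negInf w (2 * M + 1 : ℕ) * (qInf (w ^ 2) (w ^ 2))⁻¹ *
      ∑ l ∈ Finset.range (M + 1), (thetaTerm w (2 * M + 1 : ℕ) p i (2 * l) j -
        thetaTerm w (2 * M + 1 : ℕ) p i (2 * i + 1 + 2 * l) j)) _ :=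
    (hasSum_sum fun l hl => (hA l).sub (hB l hl)).mul_left _
  have h3 := h1.unique (hasSum_of_eq h2 (fun j => ?_) rfl)
  · have h6 : ∑ l ∈ Finset.range (M + 1), J (M - l) = ∑ l ∈ Finset.range (M + 1), J l := by
      simpa using Finset.sum_range_reflect J (M + 1)
    simp only [sub_neg_eq_add] at h3
    rw [Finset.sum_add_distrib, h6] at h3
    have h4 : S = negInf w (2 * M + 1 : ℕ) * (qInf (w ^ 2) (w ^ 2))⁻¹ *
      ∑ l ∈ Finset.range (M + 1), J l := by linear_combination h3 / 2
    rw [h4, dOdd, negInf, zpow_natCast, div_eq_mul_inv, Finset.mul_sum, Finset.mul_sum]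
    refine Finset.sum_congr rfl fun l _ => ?_
    have e2 : (w ^ 2) ^ (2 * (p + 2) - 1) = w ^ (2 * (2 * p + 3)) := by
      rw [← pow_mul, show 2 * (p + 2) - 1 = 2 * p + 3 by omega]
    simp only [hJ]
    rw [e2]
    rw [show ((2 * p + 3 : ℕ) + (2 * p + 2 - 2 * M - 2 * i + 4 * l) : ℤ) =
        2 * (2 * (p + 2 : ℕ) - i - M + 2 * l) - 3 by push_cast; ring,
      show ((2 * p + 3 : ℕ) - (2 * p + 2 - 2 * M - 2 * i + 4 * l) : ℤ) =
        2 * (i + M - 2 * l) + 1 by push_cast; ring,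
      show (-(2 * p + 1) * M ^ 2 + 2 * (i - p - 1) * M : ℤ) =
        (3 - 2 * (p + 2 : ℕ)) * M ^ 2 + 2 * (1 + i - (p + 2 : ℕ)) * M by push_cast; ring]
    ring
  · simp only [Function.comp_apply, Equiv.subLeft_apply]
    rw [alphaTotal_add_reflect hw0 hw]
    have h1 := one_add_zpow_ne_zero hw ((2 * M + 1 : ℕ) + 2 * j)
    simp only [thetaTerm]
    generalize w ^ (((2 * M + 1 : ℕ) : ℤ) + 2 * j) = y at *
    have h5 : (∑ a ∈ Finset.range (2 * i + 1), y ^ a) *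
        (1 + (-1) ^ (2 * M + 1) * y ^ (2 * M + 1 + 1)) / (1 + y) =
        ∑ l ∈ Finset.range (M + 1), (y ^ (2 * l) - y ^ (2 * i + 1 + 2 * l)) := by
      rw [div_eq_iff h1]
      have e1 := mul_neg_geom_sum y (2 * i + 1)
      have e2 := mul_neg_geom_sum (y ^ 2) (M + 1)
      simp only [pow_add y (2 * i + 1), Finset.sum_sub_distrib, ← Finset.mul_sum, pow_mul]
      rw [Odd.neg_one_pow ⟨M, rfl⟩, show 2 * M + 1 + 1 = 2 * (M + 1) by ring, pow_mul]
      linear_combination (1 + y) * (∑ l ∈ Finset.range (M + 1), (y ^ 2) ^ l) * e1 -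
        (∑ a ∈ Finset.range (2 * i + 1), y ^ a) * e2
    rw [h5, Finset.mul_sum]
    congr 1
    exact Finset.sum_congr rfl fun l _ => by ring

end Theta

/-! ### Identification with the original summands. -/

noncomputable section

/-- The summand of the `m`-version as a product of transfer factors, where `q = w ^ 2`. -/
def chainTerm (w : ℂ) (m : ℤ) (p i : ℕ) (s : Fin (p + 2) → ℤ) : ℂ :=
  topWeight w m i (s 0) * ∏ k : Fin (p + 1), transfer w m p i k (s k.castSucc) (s k.succ)

end

section Assembly

variable {w : ℂ}

/-- The factors 1/(q)_{s_k - s_{k+1}} enforce monotonicity and the binomial coefficient the lower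
bound, so the sum over chains equals the sum over all integer vectors. -/
theorem mem_chains_of_chainTerm_ne_zero (hw0 : w ≠ 0) (hw : ‖w‖ < 1) {m p i : ℕ}
    {s : Fin (p + 2) → ℤ} (h : chainTerm w m p i s ≠ 0) : s ∈ chains (p + 2) (-(m / 2 : ℕ)) := by
  have h1 : ∀ k : Fin (p + 1), transfer w m p i k (s k.castSucc) (s k.succ) ≠ 0 := fun k =>
    Finset.prod_ne_zero_iff.mp (right_ne_zero_of_mul h) k (Finset.mem_univ k)
  have h2 : Antitone s := Fin.antitone_iff_succ_le.mpr fun k => by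
    by_contra! hlt
    apply h1 k
    rw [transfer]
    split_ifs <;> simp [invFact_of_neg hw0 hw (show s k.castSucc - s k.succ < 0 by omega)]
  have h3 : 0 ≤ (m : ℤ) + 2 * s (Fin.last (p + 1)) := by
    by_contra! hlt
    apply h1 (Fin.last p)
    have hlt' : (m : ℤ) + 2 * s (Fin.last p).succ < 0 := hlt
    rw [transfer, Fin.val_last, if_neg (lt_irrefl p), qBinom, if_neg (by omega)]
    simp
  refine ⟨h2, fun j => ?_⟩
  have := h2 (Fin.le_last j)
  omega

theorem summable_chainTerm (hw0 : w ≠ 0) (hw : ‖w‖ < 1) (m p i : ℕ) :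
    Summable (chainTerm w m p i) := by
  obtain ⟨g, hg0, hg, hgT⟩ := exists_norm_topWeight_le hw0 hw m i
  choose f hf0 hf hfT using fun k : Fin (p + 1) =>
    exists_norm_transfer_le hw0 hw m p i k
  have hsum := summable_prod_coord (f := Fin.cons g f) (fun k x => by
    refine Fin.cases ?_ (fun k => ?_) k
    · exact hg0 x
    · exact hf0 k x) (fun k => by
    refine Fin.cases ?_ (fun k => ?_) k
    · exact hg
    · exact hf k)
  refine Summable.of_norm_bounded hsum fun s => ?_
  rw [Fin.prod_univ_succ]
  simp only [Fin.cons_zero, Fin.cons_succ]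
  by_cases h : chainTerm w m p i s = 0
  · rw [h, norm_zero]
    exact mul_nonneg (hg0 _) (Finset.prod_nonneg fun k _ => hf0 k _)
  · have hs : ∀ j, -(m : ℤ) ≤ s j := fun j => by
      have := (mem_chains_of_chainTerm_ne_zero hw0 hw h).2 j
      omega
    rw [chainTerm, norm_mul, norm_prod]
    exact mul_le_mul (hgT _ (hs _)) (Finset.prod_le_prod (fun _ _ => norm_nonneg _) fun k _ =>
      hfT k _ _ (hs _) (hs _)) (Finset.prod_nonneg fun _ _ => norm_nonneg _) (hg0 _)

theorem exists_hasSum_chainTerm (hw0 : w ≠ 0) (hw : ‖w‖ < 1) (m : ℕ) {p i : ℕ} (hi : i ≤ p + 1) :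
    ∃ S, HasSum (alphaTotal w m p i) S ∧
      HasSum (fun s : chains (p + 2) (-(m / 2 : ℕ)) => chainTerm w m p i s) S := by
  obtain ⟨S, h1, h2⟩ := exists_hasSum_alphaTotal hw0 hw (Int.natCast_nonneg m) p i
  refine ⟨S, h1, ?_⟩
  have hv : ∀ x, lowerSum w m p i (p + 1) x = 1 := fun x => by
    rw [lowerSum, if_neg (by omega)]
  have h3 := hasSum_chain (T := transfer w m p i)
    (fun k hk x => hasSum_transfer hw0 hw (Int.natCast_nonneg m) hi hk x)
    ((summable_chainTerm hw0 hw m p i).congr fun s => by rw [hv, mul_one, chainTerm]) h2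
  have h4 : HasSum (chainTerm w m p i) S := hasSum_of_eq h3 (fun s => by
    rw [hv, mul_one, chainTerm]) rfl
  exact (hasSum_subtype_iff_of_support_subset
    fun s hs => mem_chains_of_chainTerm_ne_zero hw0 hw hs).mpr h4

theorem entry_succ {n : ℕ} (s : Fin n → ℤ) {k : ℕ} (hk : k < n) : entry s (k + 1) = s ⟨k, hk⟩ := by
  rw [entry, dif_pos (by omega)]
  simp

theorem prod_Icc_one {M : Type*} [CommMonoid M] (f : ℕ → M) (n : ℕ) :
    ∏ j ∈ Finset.Icc 1 n, f j = ∏ k ∈ Finset.range n, f (k + 1) := by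
  rw [Finset.range_eq_Ico, Finset.prod_Ico_add' f 0 n 1]
  rfl

theorem sum_Icc_two (f : ℕ → ℤ) (p : ℕ) :
    ∑ j ∈ Finset.Icc 2 (p + 2), f j = ∑ k ∈ Finset.range p, f (k + 2) + f (p + 2) := by
  rw [← Finset.sum_range_succ (fun k => f (k + 2)), Finset.range_eq_Ico,
    Finset.sum_Ico_add' f 0 (p + 1) 2]
  rfl

theorem sum_Icc_one_eq_ite (f : ℕ → ℤ) {i p : ℕ} (hi : i ≤ p + 1) :
    ∑ j ∈ Finset.Icc 1 i, f j = (∑ k ∈ Finset.range p, if k + 2 ≤ i then f (k + 2) else 0) +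
      if 1 ≤ i then f 1 else 0 := by
  rw [← Finset.sum_range_succ' (fun k => if k + 1 ≤ i then f (k + 1) else 0), Finset.sum_ite,
    Finset.sum_const_zero, add_zero]
  refine (Finset.sum_bij (fun k _ => k + 1) (fun k hk => ?_) (fun _ _ _ _ h => by omega)
    (fun j hj => ?_) fun _ _ => rfl).symm
  · simp only [Finset.mem_filter, Finset.mem_range, Finset.mem_Icc] at *
    omega
  · simp only [Finset.mem_filter, Finset.mem_range, Finset.mem_Icc] at *
    exact ⟨j - 1, by omega, by omega⟩

theorem zpow_sum (hw0 : w ≠ 0) {ι : Type*} (t : Finset ι) (f : ι → ℤ) :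
    w ^ (∑ k ∈ t, f k) = ∏ k ∈ t, w ^ f k := by
  classical
  induction t using Finset.induction_on with
  | empty => simp
  | insert a t ha ih => rw [Finset.sum_insert ha, Finset.prod_insert ha, zpow_add₀ hw0, ih]

theorem qPoch_neg (hw0 : w ≠ 0) (c : ℕ) (k : ℤ) :
    qPoch (-w ^ c) (w ^ 2) k = negInf w c / negInf w (c + 2 * k) := by
  rw [qPoch, negInf, negInf, zpow_natCast, zpow_add₀ hw0, zpow_mul, zpow_natCast, neg_mul]
  norm_cast

theorem mTerm_eq_chainTerm (hw0 : w ≠ 0) (hw : ‖w‖ < 1) (m : ℕ) {p i : ℕ} (hi : i ≤ p + 1)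
    (s : Fin (p + 2) → ℤ) : mTerm (w ^ 2) w (p + 2) i m s = chainTerm w m p i s := by
  have h1 : chainTerm w m p i s = topWeight w m i (entry s 1) *
      ∏ k ∈ Finset.range (p + 1), transfer w m p i k (entry s (k + 1)) (entry s (k + 2)) := by
    rw [chainTerm, entry_succ s (show 0 < p + 2 by omega), Finset.prod_range]
    congr 1
    refine Finset.prod_congr rfl fun k _ => ?_
    rw [entry_succ s (show (k : ℕ) < p + 2 by omega), entry_succ s (show (k : ℕ) + 1 < p + 2 by omega)]
    rfl
  rw [h1, mTerm]
  generalize entry s = e at *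
  have h2 : ∏ k ∈ Finset.range p, transfer w m p i k (e (k + 1)) (e (k + 2)) =
      (∏ k ∈ Finset.range p, invFact w (e (k + 1) - e (k + 2))) *
        w ^ (∑ k ∈ Finset.range p, (2 * e (k + 2) ^ 2 + 2 * m * e (k + 2) -
          if k + 2 ≤ i then 2 * e (k + 2) else 0)) := by
    rw [zpow_sum hw0, ← Finset.prod_mul_distrib]
    exact Finset.prod_congr rfl fun k hk => by rw [transfer, if_pos (Finset.mem_range.mp hk)]
  -- The part in s_r, including -(m+1)s_r, splits into the weight s_r² + m s_r of the Bailey step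
  -- and s_r² - s_r of the initial β.
  have h3 : (e 1 ^ 2 + 2 * ∑ j ∈ Finset.Icc 2 (p + 2), e j ^ 2 +
      m * (e 1 + 2 * ∑ j ∈ Finset.Icc 2 (p + 2), e j) + e 1 -
      2 * ∑ j ∈ Finset.Icc 1 i, e j - (m + 1) * e (p + 2) : ℤ) =
      (e 1 ^ 2 + m * e 1 + e 1 - if 1 ≤ i then 2 * e 1 else 0) +
      (∑ k ∈ Finset.range p, (2 * e (k + 2) ^ 2 + 2 * m * e (k + 2) -
          if k + 2 ≤ i then 2 * e (k + 2) else 0)) +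
      (e (p + 2) ^ 2 + m * e (p + 2)) + (e (p + 2) ^ 2 - e (p + 2)) := by
    rw [sum_Icc_two e, sum_Icc_two fun j => e j ^ 2, sum_Icc_one_eq_ite e hi,
      Finset.sum_sub_distrib, Finset.sum_add_distrib, ← Finset.mul_sum, ← Finset.mul_sum]
    simp only [← mul_ite_zero, ← Finset.mul_sum]
    ring
  rw [h3, show p + 2 - 1 = p + 1 from rfl, prod_Icc_one, Finset.prod_range_succ,
    Finset.prod_range_succ, h2, transfer, if_neg (lt_irrefl p), topWeight, qPoch_neg hw0,
    qPoch_neg hw0, qPoch_neg hw0, zpow_add₀ hw0, zpow_add₀ hw0, zpow_add₀ hw0]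
  simp only [qPoch_self hw0, Finset.prod_inv_distrib, Nat.cast_add, Nat.cast_one]
  have n0 := negInf_ne_zero hw0 hw (m + 1)
  have n1 := negInf_ne_zero hw0 hw (m + 1 + 2 * e (p + 1))
  have n2 := negInf_ne_zero hw0 hw (m + 1 + 2 * e (p + 2))
  have n3 := negInf_ne_zero hw0 hw (m + 2 * e 1)
  field_simp

theorem hasSum_mTerm_even (hw0 : w ≠ 0) (hw : ‖w‖ < 1) (m : ℕ) {p i : ℕ} (hi : i ≤ p + 1) :
    HasSum (fun s : chains (p + 2) (-((2 * m / 2 : ℕ) : ℤ)) => mTerm (w ^ 2) w (p + 2) i (2 * m) s)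
      (dEven (w ^ 2) w (p + 2) i m) := by
  obtain ⟨S, h1, h2⟩ := exists_hasSum_chainTerm hw0 hw (2 * m) hi
  rw [← hasSum_alphaTotal_even hw0 hw m p i h1]
  simpa only [mTerm_eq_chainTerm hw0 hw _ hi] using h2

theorem hasSum_mTerm_odd (hw0 : w ≠ 0) (hw : ‖w‖ < 1) (m : ℕ) {p i : ℕ} (hi : i ≤ p + 1) :
    HasSum (fun s : chains (p + 2) (-(((2 * m + 1) / 2 : ℕ) : ℤ)) =>
      mTerm (w ^ 2) w (p + 2) i (2 * m + 1) s) (dOdd (w ^ 2) w (p + 2) i m) := by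
  obtain ⟨S, h1, h2⟩ := exists_hasSum_chainTerm hw0 hw (2 * m + 1) hi
  rw [← hasSum_alphaTotal_odd hw0 hw m p i h1]
  simpa only [mTerm_eq_chainTerm hw0 hw _ hi] using h2

/-- The appended 0 agrees with the default value 0 of `entry` at position n + 1. -/
theorem entry_snoc_zero {n : ℕ} (s : Fin n → ℤ) (j : ℕ) :
    entry (Fin.snoc s 0 : Fin (n + 1) → ℤ) j = entry s j := by
  rcases Nat.eq_zero_or_pos j with rfl | hj
  · simp [entry]
  obtain ⟨k, rfl⟩ : ∃ k, j = k + 1 := ⟨j - 1, by omega⟩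
  rcases lt_trichotomy k n with h | rfl | h
  · rw [entry_succ s h, entry_succ _ (h.trans (Nat.lt_succ_self n))]
    exact Fin.snoc_castSucc (α := fun _ => ℤ) 0 s ⟨k, h⟩
  · rw [entry_succ _ (Nat.lt_succ_self k), entry, dif_neg (by omega)]
    exact Fin.snoc_last (α := fun _ => ℤ) 0 s
  · rw [entry, entry, dif_neg (by omega), dif_neg (by omega)]

theorem zeroTerm_eq_mTerm (hw0 : w ≠ 0) (hw : ‖w‖ < 1) (p i : ℕ) (s : Fin (p + 1) → ℤ) :
    zeroTerm (w ^ 2) w (p + 2) i s = mTerm (w ^ 2) w (p + 2) i 0 (Fin.snoc s 0) := by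
  have h0 : entry s (p + 2) = 0 := by rw [entry, dif_neg (by omega)]
  have hn := negInf_ne_zero hw0 hw 1
  rw [mTerm, zeroTerm]
  simp only [entry_snoc_zero]
  change _ / ((∏ j ∈ Finset.Icc 1 p, _) * qPoch _ _ (entry s (p + 1)) *
    qPoch _ _ (entry s (p + 1))) = _ / ((∏ j ∈ Finset.Icc 1 (p + 1), _) *
    qPoch _ _ (entry s (p + 1))) * _ * _
  change w ^ (_ + 2 * ∑ j ∈ Finset.Icc 2 (p + 1), _ + _ - _) * _ / _ = _
  have hs : ∀ f : ℕ → ℤ, ∑ j ∈ Finset.Icc 2 (p + 2), f j =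
      ∑ j ∈ Finset.Icc 2 (p + 1), f j + f (p + 2) := fun f => Finset.sum_Icc_succ_top (by omega) f
  rw [Finset.prod_Icc_succ_top (by omega), hs, hs, h0, qBinom_eq hw0]
  have e1 : qPoch (-w) (w ^ 2) 0 = 1 := by
    have := qPoch_neg hw0 1 0
    rw [pow_one] at this
    rw [this]
    simpa using div_self hn
  simp [e1, invFact_zero hw]

/-- For m = 0 the factor [s_r over 2s_r] vanishes unless s_r = 0, so the sum lives on chains
obtained by appending a zero. -/
theorem hasSum_zeroTerm (hw0 : w ≠ 0) (hw : ‖w‖ < 1) {p i : ℕ} (hi : i ≤ p + 1) :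
    HasSum (fun s : chains (p + 1) 0 => zeroTerm (w ^ 2) w (p + 2) i s.1)
      (dEven (w ^ 2) w (p + 2) i 0) := by
  have h := hasSum_mTerm_even hw0 hw 0 hi
  have hmem : ∀ s : chains (p + 1) 0,
      (Fin.snoc s.1 0 : Fin (p + 2) → ℤ) ∈ chains (p + 2) (-((2 * 0 / 2 : ℕ) : ℤ)) := fun s => by
    refine ⟨Fin.antitone_iff_succ_le.mpr fun k => ?_, fun j => ?_⟩
    · rw [Fin.snoc_castSucc (α := fun _ => ℤ)]
      refine Fin.lastCases ?_ (fun k => ?_) k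
      · rw [Fin.succ_last]
        exact (Fin.snoc_last (α := fun _ => ℤ) 0 s.1).le.trans (s.2.2 _)
      · rw [Fin.succ_castSucc, Fin.snoc_castSucc (α := fun _ => ℤ)]
        exact s.2.1 (Fin.castSucc_le_succ k)
    · refine Fin.lastCases ?_ (fun k => ?_) j
      · simp
      · simpa using s.2.2 k
  have hinj : Function.Injective fun s : chains (p + 1) 0 =>
      (⟨Fin.snoc s.1 0, hmem s⟩ : chains (p + 2) (-((2 * 0 / 2 : ℕ) : ℤ))) := fun s t hst => by
    have := congrArg Fin.init (congrArg Subtype.val hst)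
    simp only [Fin.init_snoc] at this
    exact Subtype.ext this
  rw [← hinj.hasSum_iff] at h
  · exact hasSum_of_eq h (fun s => zeroTerm_eq_mTerm hw0 hw p i s) rfl
  · intro s hs
    by_contra hne
    have hl : entry s.1 (p + 2) = 0 := by
      by_contra h0
      apply hne
      rw [mTerm, qBinom, if_neg (by push_cast; omega), mul_zero]
    rw [entry_succ s.1 (Nat.lt_succ_self (p + 1))] at hl
    refine hs ⟨⟨Fin.init s.1, ?_, fun j => ?_⟩, Subtype.ext ?_⟩
    · exact fun a b hab => s.2.1 (Fin.castSucc_le_castSucc_iff.mpr hab)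
    · simpa [Fin.init] using s.2.2 j.castSucc
    · have := Fin.snoc_init_self s.1
      rw [show s.1 (Fin.last (p + 1)) = 0 from hl] at this
      exact this

theorem dEven_zero (hw : ‖w‖ < 1) (r i : ℕ) : dEven (w ^ 2) w r i 0 =
    qInf (-w ^ 2) (w ^ 2) / qInf (w ^ 2) (w ^ 2) * ∑ k ∈ Finset.range (2 * i + 1),
      qInf₃ ((w ^ 2) ^ (2 * r - 1)) (w ^ (2 * (r - i + k) - 1 : ℤ)) (w ^ (2 * (r + i - k) - 1 : ℤ))
        ((w ^ 2) ^ (2 * r - 1)) := by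
  -- The first factor 1 - (-1) = 2 cancels the 2 in the denominator of d_0.
  have h : qInf (-1) (w ^ 2) = 2 * qInf (-w ^ 2) (w ^ 2) := by
    rw [qInf_eq_mul _ (norm_sq_lt_one hw)]
    norm_num
  rw [dEven, pow_zero, h, mul_div_mul_left _ _ two_ne_zero]
  simp

end Assembly

end QSeries

theorem theorem2p9 (q w : ℂ) (hq0 : q ≠ 0) (hq1 : ‖q‖ < 1) (hw : w ^ 2 = q)
    (r i : ℕ) (hr : 2 ≤ r) (hi : i ≤ r - 1) :
    (∀ m : ℕ,
      HasSum (fun s : QSeries.chains r (-((2 * m / 2 : ℕ) : ℤ)) =>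
        QSeries.mTerm q w r i (2 * m) s) (QSeries.dEven q w r i m)) ∧
    (∀ m : ℕ,
      HasSum (fun s : QSeries.chains r (-(((2 * m + 1) / 2 : ℕ) : ℤ)) =>
        QSeries.mTerm q w r i (2 * m + 1) s) (QSeries.dOdd q w r i m)) ∧
    HasSum (fun s : QSeries.chains (r - 1) 0 => QSeries.zeroTerm q w r i s)
      (QSeries.qInf (-q) q / QSeries.qInf q q *
        ∑ k ∈ Finset.range (2 * i + 1),
          QSeries.qInf₃ (q ^ (2 * r - 1))
            (w ^ (2 * (r - i + k) - 1 : ℤ))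
            (w ^ (2 * (r + i - k) - 1 : ℤ))
            (q ^ (2 * r - 1))) := by
  subst hw
  have hw0 : w ≠ 0 := fun h => hq0 (by rw [h]; norm_num)
  have hw1 : ‖w‖ < 1 := by
    rw [norm_pow] at hq1
    exact (pow_lt_one_iff_of_nonneg (norm_nonneg w) two_ne_zero).mp hq1
  obtain ⟨p, rfl⟩ : ∃ p, r = p + 2 := ⟨r - 2, by omega⟩
  have hi' : i ≤ p + 1 := by omega
  refine ⟨fun m => QSeries.hasSum_mTerm_even hw0 hw1 m hi',
    fun m => QSeries.hasSum_mTerm_odd hw0 hw1 m hi', ?_⟩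
  rw [← QSeries.dEven_zero hw1]
  have h := QSeries.hasSum_zeroTerm hw0 hw1 hi'
  change HasSum (fun s : QSeries.chains (p + 1) 0 => QSeries.zeroTerm (w ^ 2) w (p + 2) i s.1) _
  exact h
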